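/- Let $A=K[x_1,\ldots,x_n]$ be a polynomial ring over a field $K$ with ideal $\mathfrak m=(x_1,\ldots,x_n)$. For a monomial ideal $J\subseteq A$ let $G(J)$ be its minimal set of monomial generators and let $\operatorname{conv}(J)\subseteq\mathbb R^n$ be the convex hull of $\{a\in\mathbb N^n : x^a\in J\}$. Call $J$ extremal if the exponent vectors of the elements of $G(J)$ are exactly the extreme points of $\operatorname{conv}(J)$. Let $\mathcal F(J)=\mathcal R(J)/\mathfrak m\mathcal R(J)$, with $\mathcal R(J)\subseteq A[t]$ the Rees ring, be the fiber ring of $J$, and $\mathcal F(J)_{\mathrm{red}}$ its quotient by the nilradical. A face of $\operatorname{conv}(J)$ is $\emptyset$, $\operatorname{conv}(J)$ itself, or the intersection of $\operatorname{conv}(J)$ with a supporting hyperplane. Let $J$ be an extremal ideal and write $G(J)=\{f_1,\ldots,f_r\}$ with $f_j=x^{a_j}$. For each compact face $F$ of $\operatorname{conv}(J)$ let $K[F]=K[f_jt : a_j\in F]\subseteq A[t]$, and for compact faces $G\subseteq F$ let $\pi_{GF}\colon K[F]\to K[G]$ be the (well-defined) $K$-algebra homomorphism with $\pi_{GF}(f_jt)=f_jt$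 if $a_j\in G$ and $\pi_{GF}(f_jt)=0$ otherwise. Then there is an isomorphism of $K$-algebras $$\mathcal F(J)_{\mathrm{red}}\;\cong\;\varprojlim_{F}K[F],$$ where the inverse limit is taken over all compact faces $F$ of $\operatorname{conv}(J)$, the empty face (with $K[\emptyset]=K$) included. If $J\neq 0$, the same holds with the inverse limit taken over the nonempty compact faces only. -/

import Mathlib

noncomputable section

namespace NewtonFiber

variable {K : Type*} [Field K] {n : ℕ}

/-- An exponent vector in `ℕⁿ`, viewed as a point of `ℝⁿ`. -/
def toReal (a : Fin n →₀ ℕ) : Fin n → ℝ := fun i => (a i : ℝ)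

/-- A monomial ideal: an ideal generated by a set of monomials `x^a`. -/
def IsMonomialIdeal (J : Ideal (MvPolynomial (Fin n) K)) : Prop :=
  ∃ S : Set (Fin n →₀ ℕ),
    J = Ideal.span ((fun a => MvPolynomial.monomial a (1 : K)) '' S)

/-- `Γ(J)`: the exponents of the monomials contained in `J`. -/
def exponents (J : Ideal (MvPolynomial (Fin n) K)) : Set (Fin n →₀ ℕ) :=
  {a | MvPolynomial.monomial a (1 : K) ∈ J}

/-- `Γ(G(J))`: the exponents of the minimal monomial generators of `J`, that is, of the monomials
in `J` that are minimal for divisibility (`x^a ∣ x^b` iff `a ≤ b` componentwise). -/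
def minGens (J : Ideal (MvPolynomial (Fin n) K)) : Set (Fin n →₀ ℕ) :=
  {a | Minimal (fun b => b ∈ exponents J) a}

/-- The Newton polyhedron `conv(J)`: the convex hull of `Γ(J)` in `ℝⁿ`. -/
def newton (J : Ideal (MvPolynomial (Fin n) K)) : Set (Fin n → ℝ) :=
  convexHull ℝ (toReal '' exponents J)

/-- Extremal ideals: monomial ideals `J` for which the exponents of the minimal monomial generators
are exactly the extreme points of `conv(J)`. -/
def IsExtremalIdeal (J : Ideal (MvPolynomial (Fin n) K)) : Prop :=
  IsMonomialIdeal J ∧ toReal '' minGens J = Set.extremePoints ℝ (newton J)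

/-- The maximal ideal `𝔪 = (x₁, …, xₙ)`. -/
def irrelevantIdeal (K : Type*) [Field K] (n : ℕ) : Ideal (MvPolynomial (Fin n) K) :=
  Ideal.span (Set.range MvPolynomial.X)

/-- The fiber ring `F(J) = R(J) / 𝔪 R(J)`, where `R(J) ⊆ K[x₁, …, xₙ][t]` is the Rees ring. -/
def FiberRing (J : Ideal (MvPolynomial (Fin n) K)) : Type _ :=
  reesAlgebra J ⧸ (irrelevantIdeal K n).map
    (algebraMap (MvPolynomial (Fin n) K) (reesAlgebra J))

instance (J : Ideal (MvPolynomial (Fin n) K)) : CommRing (FiberRing J) :=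
  inferInstanceAs (CommRing (reesAlgebra J ⧸ (irrelevantIdeal K n).map
    (algebraMap (MvPolynomial (Fin n) K) (reesAlgebra J))))

instance (J : Ideal (MvPolynomial (Fin n) K)) : Algebra K (FiberRing J) :=
  inferInstanceAs (Algebra K (reesAlgebra J ⧸ (irrelevantIdeal K n).map
    (algebraMap (MvPolynomial (Fin n) K) (reesAlgebra J))))

/-- The reduced fiber ring `F(J)_red`: the fiber ring modulo its nilradical. -/
def ReducedFiberRing (J : Ideal (MvPolynomial (Fin n) K)) : Type _ :=
  FiberRing J ⧸ nilradical (FiberRing J)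

instance (J : Ideal (MvPolynomial (Fin n) K)) : CommRing (ReducedFiberRing J) :=
  inferInstanceAs (CommRing (FiberRing J ⧸ nilradical (FiberRing J)))

instance (J : Ideal (MvPolynomial (Fin n) K)) : Algebra K (ReducedFiberRing J) :=
  inferInstanceAs (Algebra K (FiberRing J ⧸ nilradical (FiberRing J)))

/-- The compact faces of `conv(J)`. A set is exposed in `X` iff it is empty, or `X` itself, or
`X ∩ H` for a supporting hyperplane `H` of `X`, so `IsExposed` says "face". The empty face is
included here. -/
abbrev CompactFace (J : Ideal (MvPolynomial (Fin n) K)) : Type :=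
  {F : Set (Fin n → ℝ) // IsExposed ℝ (newton J) F ∧ IsCompact F}

/-- The exponents `a` of the minimal monomial generators of `J` with `a ∈ F`. -/
def faceGens (J : Ideal (MvPolynomial (Fin n) K)) (F : Set (Fin n → ℝ)) : Set (Fin n →₀ ℕ) :=
  {a | a ∈ minGens J ∧ toReal a ∈ F}

/-- The element `x^a t` of `K[x₁, …, xₙ][t]`. -/
def monT (K : Type*) [Field K] (a : Fin n →₀ ℕ) : Polynomial (MvPolynomial (Fin n) K) :=
  Polynomial.monomial 1 (MvPolynomial.monomial a (1 : K))

/-- The semigroup ring `K[F] = K[f_j t : a_j ∈ F]`, as a subalgebra of `K[x₁, …, xₙ][t]`. -/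
def faceRing (J : Ideal (MvPolynomial (Fin n) K)) (F : Set (Fin n → ℝ)) :
    Subalgebra K (Polynomial (MvPolynomial (Fin n) K)) :=
  Algebra.adjoin K (monT K '' faceGens J F)

/-- The generator `x^a t` of `K[F]`. -/
def faceGen (J : Ideal (MvPolynomial (Fin n) K)) (F : Set (Fin n → ℝ)) (a : faceGens J F) :
    faceRing J F :=
  ⟨monT K a.1, Algebra.subset_adjoin ⟨a.1, a.2, rfl⟩⟩

/-- The presentation `K[y_j : a_j ∈ F] → K[F]`, `y_j ↦ f_j t`. -/
def present (J : Ideal (MvPolynomial (Fin n) K)) (F : Set (Fin n → ℝ)) :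
    MvPolynomial (faceGens J F) K →ₐ[K] faceRing J F :=
  MvPolynomial.aeval (faceGen J F)

open Classical in
/-- The map `K[y_j : a_j ∈ F] → K[G]` with `y_j ↦ f_j t` if `a_j ∈ G`, and `y_j ↦ 0` otherwise. -/
def presentTo (J : Ideal (MvPolynomial (Fin n) K)) (F G : Set (Fin n → ℝ)) :
    MvPolynomial (faceGens J F) K →ₐ[K] faceRing J G :=
  MvPolynomial.aeval fun a =>
    if h : toReal a.1 ∈ G then faceGen J G ⟨a.1, a.2.1, h⟩ else 0

theorem present_surjective (J : Ideal (MvPolynomial (Fin n) K)) (F : Set (Fin n → ℝ)) :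
    Function.Surjective (present J F) := by
  rintro ⟨p, hp⟩
  have h : faceRing J F =
      (MvPolynomial.aeval (R := K) (fun a : faceGens J F => monT K a.1)).range := by
    rw [← Algebra.adjoin_range_eq_range_aeval, faceRing]
    congr 1
    ext x
    simp
  have hp' := hp
  rw [h] at hp'
  obtain ⟨q, hq⟩ := hp'
  refine ⟨q, Subtype.ext ?_⟩
  change _ = p
  rw [← hq]
  have : (faceRing J F).val.comp (present J F) =
      MvPolynomial.aeval (R := K) (fun a : faceGens J F => monT K a.1) := by
    ext a : 1
    simp [present, faceGen]
  exact DFunLike.congr_fun this q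

theorem prod_monT {ι : Type*} (g : ι → Fin n →₀ ℕ) (e : ι →₀ ℕ) :
    (e.prod fun i k => monT K (g i) ^ k) =
      Polynomial.monomial (e.sum fun _ k => k)
        (MvPolynomial.monomial (e.sum fun i k => k • g i) (1 : K)) := by
  classical
  induction e using Finsupp.induction with
  | zero => simp
  | single_add i k f hi hk ih =>
    rw [Finsupp.prod_add_index' (by simp) (by intros; rw [pow_add]), ih,
      Finsupp.sum_add_index' (by simp) (by simp),
      Finsupp.sum_add_index' (by simp) (by intros; rw [add_smul])]
    simp [monT, Polynomial.monomial_pow, MvPolynomial.monomial_pow,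
      Polynomial.monomial_mul_monomial, MvPolynomial.monomial_mul]

/-- Whether a product of generators of `K[F]` involves only generators of `K[G]` can be read off
from its exponent. -/
theorem exists_face_criterion (J : Ideal (MvPolynomial (Fin n) K)) (F G : CompactFace J) :
    ∃ P : ℕ → (Fin n →₀ ℕ) → Prop, ∀ e : faceGens J F.1 →₀ ℕ,
      P (e.sum fun _ k => k) (e.sum fun i k => k • i.1) ↔ ∀ a ∈ e.support, toReal a.1 ∈ G.1 := by
  classical
  by_cases hG : G.1.Nonempty
  · obtain ⟨l, hl⟩ := G.2.1 hG
    obtain ⟨g, hg⟩ := hG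
    have hg' := hg
    rw [hl] at hg'
    let T : (Fin n →₀ ℕ) →+ ℝ :=
      { toFun := fun a => l (toReal a)
        map_zero' := by
          have : toReal (0 : Fin n →₀ ℕ) = 0 := by ext; simp [toReal]
          rw [this, map_zero]
        map_add' := fun a b => by
          have : toReal (a + b) = toReal a + toReal b := by ext; simp [toReal]
          rw [this, map_add] }
    refine ⟨fun k b => T b = k * l g, fun e => ?_⟩
    have hle : ∀ a : faceGens J F.1, T a.1 ≤ l g := fun a =>
      hg'.2 _ (F.2.1.subset a.2.2)
    have hiff : ∀ a : faceGens J F.1, T a.1 = l g ↔ toReal a.1 ∈ G.1 := fun a => by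
      rw [hl]
      refine ⟨fun h => ⟨F.2.1.subset a.2.2, fun y hy => ?_⟩, fun h => le_antisymm (hle a) ?_⟩
      · exact (hg'.2 y hy).trans_eq h.symm
      · exact h.2 g hg'.1
    have h1 : T (e.sum fun i k => k • i.1) = ∑ a ∈ e.support, (e a : ℝ) * T a.1 := by
      rw [Finsupp.sum, map_sum]
      simp
    have h2 : ((e.sum fun _ k => k : ℕ) : ℝ) * l g = ∑ a ∈ e.support, (e a : ℝ) * l g := by
      rw [Finsupp.sum, Nat.cast_sum, Finset.sum_mul]
    change T _ = _ * _ ↔ _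
    rw [h1, h2, Finset.sum_eq_sum_iff_of_le
      (fun a _ => mul_le_mul_of_nonneg_left (hle a) (Nat.cast_nonneg _))]
    refine forall₂_congr fun a ha => ?_
    rw [← hiff a]
    have : (e a : ℝ) ≠ 0 := by exact_mod_cast Finsupp.mem_support_iff.1 ha
    exact mul_right_inj' this
  · rw [Set.not_nonempty_iff_eq_empty] at hG
    refine ⟨fun k _ => k = 0, fun e => ?_⟩
    change (e.sum fun _ k => k) = 0 ↔ _
    rw [hG, Finsupp.sum, Finset.sum_eq_zero_iff]
    refine forall₂_congr fun a ha => ?_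
    simpa using Finsupp.mem_support_iff.1 ha

theorem present_coe_monomial (J : Ideal (MvPolynomial (Fin n) K)) (F : Set (Fin n → ℝ))
    (e : faceGens J F →₀ ℕ) :
    ((present J F (MvPolynomial.monomial e 1) : faceRing J F) :
      Polynomial (MvPolynomial (Fin n) K)) =
      Polynomial.monomial (e.sum fun _ k => k)
        (MvPolynomial.monomial (e.sum fun i k => k • i.1) (1 : K)) := by
  rw [← prod_monT, present, MvPolynomial.aeval_monomial]
  simp [Finsupp.prod, faceGen]

open Classical in
theorem presentTo_coe_monomial (J : Ideal (MvPolynomial (Fin n) K)) (F G : Set (Fin n → ℝ))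
    (e : faceGens J F →₀ ℕ) :
    ((presentTo J F G (MvPolynomial.monomial e 1) : faceRing J G) :
      Polynomial (MvPolynomial (Fin n) K)) =
      if ∀ a ∈ e.support, toReal a.1 ∈ G then
        Polynomial.monomial (e.sum fun _ k => k)
          (MvPolynomial.monomial (e.sum fun i k => k • i.1) (1 : K))
      else 0 := by
  rw [presentTo, MvPolynomial.aeval_monomial, map_one, one_mul]
  split_ifs with h
  · rw [← prod_monT, Finsupp.prod, Finsupp.prod, SubmonoidClass.coe_finsetProd]
    refine Finset.prod_congr rfl fun a ha => ?_
    rw [dif_pos (h a ha)]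
    rfl
  · push Not at h
    obtain ⟨a, ha, haG⟩ := h
    rw [Finsupp.prod, Finset.prod_eq_zero ha]
    · rfl
    · rw [dif_neg haG, zero_pow (Finsupp.mem_support_iff.1 ha)]

theorem coeff_presentTo (J : Ideal (MvPolynomial (Fin n) K)) (F G : CompactFace J) :
    ∃ P : ℕ → (Fin n →₀ ℕ) → Prop, ∀ (q : MvPolynomial (faceGens J F.1) K) (k : ℕ)
      (b : Fin n →₀ ℕ),
      (P k b → ((presentTo J F.1 G.1 q).1.coeff k).coeff b =
        ((present J F.1 q).1.coeff k).coeff b) ∧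
      (¬ P k b → ((presentTo J F.1 G.1 q).1.coeff k).coeff b = 0) := by
  classical
  obtain ⟨P, hP⟩ := exists_face_criterion J F G
  refine ⟨P, fun q k b => ?_⟩
  induction q using MvPolynomial.induction_on' with
  | monomial e c =>
    have hc : MvPolynomial.monomial e c = c • MvPolynomial.monomial e (1 : K) := by
      simp [MvPolynomial.smul_monomial]
    rw [hc, map_smul, map_smul, Subalgebra.coe_smul, Subalgebra.coe_smul, presentTo_coe_monomial,
      present_coe_monomial]
    by_cases he : ∀ a ∈ e.support, toReal a.1 ∈ G.1
    · rw [if_pos he]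
      refine ⟨fun _ => rfl, fun h => ?_⟩
      rw [Polynomial.coeff_smul, Polynomial.coeff_monomial]
      split_ifs with hk
      · rw [MvPolynomial.coeff_smul, MvPolynomial.coeff_monomial, if_neg, smul_zero]
        rintro rfl
        exact h (hk ▸ (hP e).2 he)
      · simp
    · rw [if_neg he]
      refine ⟨fun h => ?_, fun _ => by simp⟩
      rw [Polynomial.coeff_smul, Polynomial.coeff_smul, Polynomial.coeff_monomial]
      split_ifs with hk
      · rw [MvPolynomial.coeff_smul, MvPolynomial.coeff_smul, MvPolynomial.coeff_monomial, if_neg]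
        · simp
        · rintro rfl
          exact he ((hP e).1 (hk ▸ h))
      · simp
  | add p q hp hq =>
    simp only [map_add, Subalgebra.coe_add, Polynomial.coeff_add, MvPolynomial.coeff_add]
    exact ⟨fun h => by rw [hp.1 h, hq.1 h], fun h => by rw [hp.2 h, hq.2 h, add_zero]⟩

theorem presentTo_eq_zero (J : Ideal (MvPolynomial (Fin n) K)) (F G : CompactFace J)
    (q : MvPolynomial (faceGens J F.1) K) (hq : q ∈ RingHom.ker (present J F.1)) :
    presentTo J F.1 G.1 q = 0 := by
  obtain ⟨P, hP⟩ := coeff_presentTo J F G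
  rw [RingHom.mem_ker] at hq
  have h0 : ((presentTo J F.1 G.1 q : faceRing J G.1) :
      Polynomial (MvPolynomial (Fin n) K)) = 0 := by
    refine Polynomial.ext fun k => MvPolynomial.ext _ _ fun b => ?_
    by_cases h : P k b
    · rw [(hP q k b).1 h, hq, ZeroMemClass.coe_zero]
    · rw [(hP q k b).2 h, Polynomial.coeff_zero, MvPolynomial.coeff_zero]
  exact ZeroMemClass.coe_eq_zero.1 h0

/-- The transition map `π_{GF} : K[F] → K[G]`, which sends `f_j t` to `f_j t` if `a_j ∈ G` and to
`0` otherwise. It is only used for `G ⊆ F`. -/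
def transition (J : Ideal (MvPolynomial (Fin n) K)) (F G : CompactFace J) :
    faceRing J F.1 →ₐ[K] faceRing J G.1 :=
  (Ideal.Quotient.liftₐ (RingHom.ker (present J F.1)) (presentTo J F.1 G.1)
    (presentTo_eq_zero J F G)).comp
    (Ideal.quotientKerAlgEquivOfSurjective (present_surjective J F.1)).symm.toAlgHom

open Classical in
/-- The transition maps have the prescribed values on the generators. -/
theorem transition_faceGen (J : Ideal (MvPolynomial (Fin n) K)) (F G : CompactFace J)
    (a : faceGens J F.1) :
    transition J F G (faceGen J F.1 a) =
      if h : toReal a.1 ∈ G.1 then faceGen J G.1 ⟨a.1, a.2.1, h⟩ else 0 := by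
  have h : present J F.1 (MvPolynomial.X a) = faceGen J F.1 a := by simp [present]
  have h' : (Ideal.quotientKerAlgEquivOfSurjective (present_surjective J F.1)).symm
      (faceGen J F.1 a) = Ideal.Quotient.mk _ (MvPolynomial.X a) := by
    rw [AlgEquiv.symm_apply_eq, Ideal.quotientKerAlgEquivOfSurjective_mk, h]
  have h'' : transition J F G (faceGen J F.1 a) =
      presentTo J F.1 G.1 (MvPolynomial.X a) := by
    change Ideal.Quotient.liftₐ (RingHom.ker (present J F.1)) (presentTo J F.1 G.1)
      (presentTo_eq_zero J F G) ((Ideal.quotientKerAlgEquivOfSurjective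
      (present_surjective J F.1)).symm (faceGen J F.1 a)) = _
    rw [h']
    rfl
  rw [h'', presentTo, MvPolynomial.aeval_X]

/-- The inverse limit of the rings `K[F]` over the compact faces `F` in the collection `𝓢`: the
algebra of the families `(m_F)` with `π_{GF}(m_F) = m_G` whenever `G ⊆ F`. -/
def inverseLimit (J : Ideal (MvPolynomial (Fin n) K)) (𝓢 : Set (CompactFace J)) :
    Subalgebra K (∀ F : 𝓢, faceRing J F.1.1) where
  carrier := {m | ∀ F G : 𝓢, G.1.1 ⊆ F.1.1 → transition J F.1 G.1 (m F) = m G}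
  mul_mem' {x y} hx hy F G h := by simp [hx F G h, hy F G h]
  add_mem' {x y} hx hy F G h := by simp [hx F G h, hy F G h]
  algebraMap_mem' c F G h := by
    rw [Pi.algebraMap_apply, Pi.algebraMap_apply, AlgHom.commutes]

end NewtonFiber

end

/-! The Rees ring is spanned by the monomials `x^b t^k` that it contains, and their bidegrees `(k,
b)` form the monoid `reesMonoid J`. Everything is read off coefficients in these bidegrees.

A nonempty compact face `F` is the locus where a strictly positive weight `w` is minimal
(`exists_weightFace_eq`). If `μ` is that minimum, the additive function `(k, b) ↦ w·b - kμ` is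
nonnegative on the Rees monoid and vanishes exactly on the bidegrees of `K[F]`
(`genMonoid_weightFace`). These bidegrees thus form a face of the monoid, so forgetting all other
monomials is a ring homomorphism from the Rees ring to `K[F]` (`toFaceRing`). The maps `π_{GF}` are
truncations of the same kind (`transition_eq`), so these homomorphisms assemble into a map to the
inverse limit.

Kernel (`ker_toInverseLimit`): variables die in every `K[F]`, and `K[F]` is reduced, so the radical
of `𝔪 R(J)` is killed. Conversely, let `x^b t^k` with `k > 0` lie over no compact face. Then no
positive weight satisfies `w·b ≤ k w·a` for all generators `a`. By Farkas' lemma some multiple of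
`b` lies strictly above `k` times a sum of generators, so a power of the monomial is divisible by a
variable inside the Rees ring (`exists_nsmul_eq_add_single`).

Surjectivity (`toInverseLimit_surjective`): a bidegree shared by `K[F]` and `K[G]` belongs to `K[F ∩
G]` (`genMonoid_inter`), so the coefficients of a compatible family glue. Only constant terms can be
shared by disjoint faces. They are compared through the empty face when it is available, and
otherwise by connectedness of the cone of positive weights (`biCoeff_zero_eq`). -/

noncomputable section

namespace NewtonFiber

variable {K : Type*} [Field K] {n : ℕ}

/-! ### Linear inequalities and a theorem of the alternative. -/

/-- **Farkas' lemma** over an ordered field: a linear form which is nonpositive wherever the forms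
`a i` are nonpositive is a nonnegative combination of the `a i`. -/
theorem farkas {𝕜 V ι : Type*} [Field 𝕜] [LinearOrder 𝕜] [IsStrictOrderedRing 𝕜] [AddCommGroup V]
    [Module 𝕜 V] (s : Finset ι) (a : ι → V →ₗ[𝕜] 𝕜) (c : V →ₗ[𝕜] 𝕜)
    (h : ∀ x, (∀ i ∈ s, a i x ≤ 0) → c x ≤ 0) :
    ∃ l : ι → 𝕜, (∀ i, 0 ≤ l i) ∧ c = ∑ i ∈ s, l i • a i := by
  classical
  induction s using Finset.induction generalizing a c with
  | empty =>
    refine ⟨0, fun _ => le_rfl, LinearMap.ext fun x => le_antisymm (h x (by simp)) ?_⟩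
    simpa using h (-x) (by simp)
  | insert j s hj ih =>
    by_cases hs : ∀ x, (∀ i ∈ s, a i x ≤ 0) → c x ≤ 0
    · obtain ⟨l, hl, rfl⟩ := ih a c hs
      refine ⟨Function.update l j 0, fun i => ?_, ?_⟩
      · by_cases hi : i = j
        · subst hi; simp
        · simpa [hi] using hl i
      · rw [Finset.sum_insert hj, Function.update_self, zero_smul, zero_add]
        refine Finset.sum_congr rfl fun i hi => ?_
        rw [Function.update_of_ne (ne_of_mem_of_not_mem hi hj)]
    · push Not at hs
      obtain ⟨z, hz, hcz⟩ := hs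
      have hjz : 0 < a j z := by
        by_contra hjz
        refine (h z fun i hi => ?_).not_gt hcz
        rcases Finset.mem_insert.1 hi with rfl | hi
        exacts [not_lt.1 hjz, hz i hi]
      -- The new forms are the old ones composed with the projection along `z` onto the kernel of `a
      -- j`, so the form `a j` drops out and induction applies.
      obtain ⟨l, hl, hc⟩ := ih (fun i => a i - (a i z / a j z) • a j) (c - (c z / a j z) • a j)
        fun x hx => by
          have := h (x - (a j x / a j z) • z) fun i hi => by
            rcases Finset.mem_insert.1 hi with rfl | hi
            · simp [hjz.ne']
            · refine le_of_eq_of_le ?_ (hx i hi)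
              simp
              ring
          refine le_of_eq_of_le ?_ this
          simp
          ring
      set t := (c z - ∑ i ∈ s, l i * a i z) / a j z with ht
      refine ⟨Function.update l j t, fun i => ?_, ?_⟩
      · by_cases hi : i = j
        · subst hi
          rw [Function.update_self]
          refine div_nonneg (sub_nonneg.2 (le_trans ?_ hcz.le)) hjz.le
          exact Finset.sum_nonpos fun i hi => mul_nonpos_of_nonneg_of_nonpos (hl i) (hz i hi)
        · simpa [hi] using hl i
      · have hu : ∑ i ∈ s, Function.update l j t i • a i = ∑ i ∈ s, l i • a i :=
          Finset.sum_congr rfl fun i hi => by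
            rw [Function.update_of_ne (ne_of_mem_of_not_mem hi hj)]
        rw [Finset.sum_insert hj, Function.update_self, hu]
        rw [sub_eq_iff_eq_add] at hc
        rw [hc]
        ext x
        have hs : ∑ i ∈ s, l i * (a i z / a j z * a j x) =
            (∑ i ∈ s, l i * a i z) / a j z * a j x := by
          rw [Finset.sum_div, Finset.sum_mul]
          exact Finset.sum_congr rfl fun i _ => by ring
        simp only [LinearMap.add_apply, LinearMap.sum_apply, LinearMap.smul_apply,
          LinearMap.sub_apply, smul_eq_mul, mul_sub, Finset.sum_sub_distrib, hs, ht]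
        ring

theorem exists_nat_mul_eq {ι : Type*} (s : Finset ι) (l : ι → ℚ) (hl : ∀ i, 0 ≤ l i) :
    ∃ (N : ℕ) (m : ι → ℕ), 0 < N ∧ ∀ i ∈ s, (N : ℚ) * l i = m i := by
  classical
  refine ⟨∏ i ∈ s, (l i).den, fun i => (∏ j ∈ s.erase i, (l j).den) * (l i).num.toNat,
    Finset.prod_pos fun i _ => (l i).pos, fun i hi => ?_⟩
  rw [← Finset.prod_erase_mul _ _ hi]
  push_cast
  rw [mul_assoc, Rat.den_mul_eq_num]
  congr 1
  have := Int.toNat_of_nonneg (Rat.num_nonneg.2 (hl i))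
  exact_mod_cast this.symm

/-- Either some strictly positive weight is nonnegative on all the vectors `v j`, or some
nonnegative integral combination of the `v j` is nonpositive and nonzero. -/
theorem exists_pos_weight_or {ι σ : Type*} [Fintype ι] [Fintype σ] (v : ι → σ → ℤ) :
    (∃ w : σ → ℝ, (∀ i, 0 < w i) ∧ ∀ j, 0 ≤ ∑ i, w i * v j i) ∨
    ∃ m : ι → ℕ, (∀ i, ∑ j, (m j : ℤ) * v j i ≤ 0) ∧ ∃ i, ∑ j, (m j : ℤ) * v j i < 0 := by
  classical
  let a : ι ⊕ σ → (σ → ℚ) →ₗ[ℚ] ℚ := Sum.elim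
    (fun j => -∑ i, (v j i : ℚ) • LinearMap.proj i) (fun i => -LinearMap.proj i)
  -- The forms `a` cut out the cone of nonnegative weights that are nonnegative on every `v j`. If a
  -- coordinate vanishes on this cone, Farkas expresses it through the forms. Working over `ℚ`
  -- allows denominators to be cleared afterwards.
  by_cases H : ∃ i, ∀ x, (∀ p ∈ Finset.univ, a p x ≤ 0) → (LinearMap.proj i : _ →ₗ[ℚ] ℚ) x ≤ 0
  · right
    obtain ⟨i₀, hi₀⟩ := H
    obtain ⟨l, hl, h⟩ := farkas _ a _ hi₀
    obtain ⟨N, m, hN, hm⟩ := exists_nat_mul_eq Finset.univ l hl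
    have key : ∀ i, ∑ j, l (.inl j) * (v j i : ℚ) = -(if i = i₀ then 1 else 0) - l (.inr i) := by
      intro i
      have := LinearMap.congr_fun h (Pi.single i 1)
      simp [a, Fintype.sum_sum_type, Pi.single_apply, eq_comm (a := i₀)] at this
      rw [this]
      ring
    have key' : ∀ i, ((∑ j, (m (.inl j) : ℤ) * v j i : ℤ) : ℚ) =
        N * (-(if i = i₀ then 1 else 0) - l (.inr i)) := by
      intro i
      rw [← key, Finset.mul_sum]
      push_cast
      refine Finset.sum_congr rfl fun j _ => ?_
      rw [← mul_assoc, hm _ (Finset.mem_univ _)]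
    have hN' : (0 : ℚ) < N := by exact_mod_cast hN
    refine ⟨fun j => m (.inl j), fun i => ?_, i₀, ?_⟩
    · have : ((∑ j, (m (.inl j) : ℤ) * v j i : ℤ) : ℚ) ≤ 0 := by
        rw [key']
        refine mul_nonpos_of_nonneg_of_nonpos hN'.le ?_
        have := hl (.inr i)
        split_ifs <;> linarith
      exact_mod_cast this
    · have : ((∑ j, (m (.inl j) : ℤ) * v j i₀ : ℤ) : ℚ) < 0 := by
        rw [key', if_pos rfl]
        refine mul_neg_of_pos_of_neg hN' ?_
        have := hl (.inr i₀)
        linarith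
      exact_mod_cast this
  · left
    push Not at H
    choose x hx hpos using H
    have hx1 : ∀ i k, 0 ≤ x i k := fun i k => by
      simpa [a] using hx i (.inr k) (Finset.mem_univ _)
    have hx2 : ∀ i j, 0 ≤ ∑ k, x i k * (v j k : ℚ) := fun i j => by
      simpa [a, mul_comm] using hx i (.inl j) (Finset.mem_univ _)
    -- For each coordinate some point of the cone is positive there; the sum of these points is
    -- positive in all coordinates.
    refine ⟨fun k => ((∑ i, x i k : ℚ) : ℝ), fun k => ?_, fun j => ?_⟩
    · have : 0 < ∑ i, x i k :=
        Finset.sum_pos' (fun i _ => hx1 i k) ⟨k, Finset.mem_univ _, hpos k⟩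
      exact Rat.cast_pos.2 this
    · have : 0 ≤ ∑ k, (∑ i, x i k) * (v j k : ℚ) := by
        simp only [Finset.sum_mul]
        rw [Finset.sum_comm]
        exact Finset.sum_nonneg fun i _ => hx2 i j
      have h : (0 : ℝ) ≤ ((∑ k, (∑ i, x i k) * (v j k : ℚ) : ℚ) : ℝ) := Rat.cast_nonneg.2 this
      rw [Rat.cast_sum] at h
      simpa only [Rat.cast_mul, Rat.cast_intCast] using h

/-! ### Coefficients and truncation by bidegree. -/

section Bidegree

/-- The monomial `c x^b t^k` of `K[x₁, …, xₙ][t]` of bidegree `u = (k, b)`. -/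
def biMonomial (u : ℕ × (Fin n →₀ ℕ)) (c : K) : Polynomial (MvPolynomial (Fin n) K) :=
  Polynomial.monomial u.1 (MvPolynomial.monomial u.2 c)

/-- The coefficient of `f` in bidegree `u = (k, b)`, that is, of the monomial `x^b t^k`. -/
def biCoeff (f : Polynomial (MvPolynomial (Fin n) K)) (u : ℕ × (Fin n →₀ ℕ)) : K :=
  (f.coeff u.1).coeff u.2

@[simp]
theorem biCoeff_zero (u : ℕ × (Fin n →₀ ℕ)) :
    biCoeff (0 : Polynomial (MvPolynomial (Fin n) K)) u = 0 := by
  simp [biCoeff]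

@[simp]
theorem biCoeff_add (f g : Polynomial (MvPolynomial (Fin n) K)) (u : ℕ × (Fin n →₀ ℕ)) :
    biCoeff (f + g) u = biCoeff f u + biCoeff g u := by
  simp [biCoeff]

@[simp]
theorem biCoeff_sum {ι : Type*} (s : Finset ι) (f : ι → Polynomial (MvPolynomial (Fin n) K))
    (u : ℕ × (Fin n →₀ ℕ)) : biCoeff (∑ i ∈ s, f i) u = ∑ i ∈ s, biCoeff (f i) u := by
  simp [biCoeff, Polynomial.finsetSum_coeff, MvPolynomial.coeff_sum]

open Classical in
theorem biCoeff_biMonomial (u v : ℕ × (Fin n →₀ ℕ)) (c : K) :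
    biCoeff (biMonomial u c) v = if u = v then c else 0 := by
  obtain ⟨k, b⟩ := u
  obtain ⟨l, d⟩ := v
  simp only [biCoeff, biMonomial, Polynomial.coeff_monomial, Prod.mk.injEq]
  by_cases hk : k = l <;> simp [hk, MvPolynomial.coeff_monomial]

theorem biCoeff_mul (f g : Polynomial (MvPolynomial (Fin n) K)) (u : ℕ × (Fin n →₀ ℕ)) :
    biCoeff (f * g) u = ∑ x ∈ Finset.HasAntidiagonal.antidiagonal u.1,
      ∑ y ∈ Finset.HasAntidiagonal.antidiagonal u.2,
      biCoeff f (x.1, y.1) * biCoeff g (x.2, y.2) := by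
  classical
  simp [biCoeff, Polynomial.coeff_mul, MvPolynomial.coeff_sum, MvPolynomial.coeff_mul]

theorem biMonomial_mul (u v : ℕ × (Fin n →₀ ℕ)) (c d : K) :
    biMonomial u c * biMonomial v d = biMonomial (u + v) (c * d) := by
  simp [biMonomial, Polynomial.monomial_mul_monomial]

theorem biMonomial_pow (u : ℕ × (Fin n →₀ ℕ)) (c : K) (N : ℕ) :
    biMonomial u c ^ N = biMonomial (N • u) (c ^ N) := by
  simp [biMonomial, Polynomial.monomial_pow, MvPolynomial.monomial_pow, mul_comm]

theorem smul_biMonomial (u : ℕ × (Fin n →₀ ℕ)) (c d : K) :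
    c • biMonomial u d = biMonomial u (c * d) := by
  simp [biMonomial, Polynomial.smul_monomial, MvPolynomial.smul_monomial]

theorem biMonomial_zero_one : biMonomial (0 : ℕ × (Fin n →₀ ℕ)) (1 : K) = 1 := by
  simp only [biMonomial, Prod.fst_zero, Prod.snd_zero]
  rfl

theorem algebraMap_eq_biMonomial (c : K) :
    algebraMap K (Polynomial (MvPolynomial (Fin n) K)) c = biMonomial 0 c := by
  rw [Algebra.algebraMap_eq_smul_one, ← biMonomial_zero_one, smul_biMonomial, mul_one]

theorem biCoeff_ext {f g : Polynomial (MvPolynomial (Fin n) K)}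
    (h : ∀ u, biCoeff f u = biCoeff g u) : f = g :=
  Polynomial.ext fun k => MvPolynomial.ext _ _ fun b => h (k, b)

theorem finite_biCoeff_ne_zero (f : Polynomial (MvPolynomial (Fin n) K)) :
    {u | biCoeff f u ≠ 0}.Finite := by
  classical
  refine (f.support.biUnion fun k => (f.coeff k).support.image (Prod.mk k)).finite_toSet.subset ?_
  rintro ⟨k, b⟩ h
  simp only [Set.mem_ofPred_eq, biCoeff] at h
  simp only [Finset.coe_biUnion, Set.mem_iUnion, Finset.mem_coe, Finset.mem_image,
    Polynomial.mem_support_iff]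
  refine ⟨k, fun h0 => h (by simp [h0]), b, MvPolynomial.mem_support_iff.2 h, rfl⟩

theorem exists_biCoeff_eq (h : ℕ × (Fin n →₀ ℕ) → K) (hh : {u | h u ≠ 0}.Finite) :
    ∃ f : Polynomial (MvPolynomial (Fin n) K), ∀ u, biCoeff f u = h u := by
  classical
  refine ⟨∑ u ∈ hh.toFinset, biMonomial u (h u), fun u => ?_⟩
  rw [biCoeff_sum, Finset.sum_congr rfl fun v _ => biCoeff_biMonomial v u (h v),
    Finset.sum_ite_eq', ite_eq_left_iff]
  intro hu
  simpa [eq_comm] using hu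

theorem eq_sum_biMonomial (f : Polynomial (MvPolynomial (Fin n) K)) :
    f = ∑ u ∈ (finite_biCoeff_ne_zero f).toFinset, biMonomial u (biCoeff f u) := by
  classical
  refine biCoeff_ext fun u => ?_
  rw [biCoeff_sum, Finset.sum_congr rfl fun v _ => biCoeff_biMonomial v u (biCoeff f v),
    Finset.sum_ite_eq', eq_comm, ite_eq_left_iff]
  intro hu
  simpa [eq_comm] using hu

open Classical in
theorem exists_restrict (P : Set (ℕ × (Fin n →₀ ℕ))) (f : Polynomial (MvPolynomial (Fin n) K)) :
    ∃ g : Polynomial (MvPolynomial (Fin n) K), ∀ u,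
      biCoeff g u = if u ∈ P then biCoeff f u else 0 :=
  exists_biCoeff_eq _ <| (finite_biCoeff_ne_zero f).subset fun u hu h => hu (by simp [h])

/-- The part of `f` supported on the bidegrees in `P`. -/
def restrict (P : Set (ℕ × (Fin n →₀ ℕ))) (f : Polynomial (MvPolynomial (Fin n) K)) :
    Polynomial (MvPolynomial (Fin n) K) :=
  (exists_restrict P f).choose

open Classical in
theorem biCoeff_restrict (P : Set (ℕ × (Fin n →₀ ℕ))) (f : Polynomial (MvPolynomial (Fin n) K))
    (u : ℕ × (Fin n →₀ ℕ)) : biCoeff (restrict P f) u = if u ∈ P then biCoeff f u else 0 :=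
  (exists_restrict P f).choose_spec u

/-- If `P` is a face of `S`, then restriction to `P` is multiplicative on the polynomials
supported on `S`. -/
theorem restrict_mul {S P : AddSubmonoid (ℕ × (Fin n →₀ ℕ))}
    (hP : ∀ u ∈ S, ∀ v ∈ S, u + v ∈ P → u ∈ P ∧ v ∈ P)
    {f g : Polynomial (MvPolynomial (Fin n) K)} (hf : ∀ u, biCoeff f u ≠ 0 → u ∈ S)
    (hg : ∀ u, biCoeff g u ≠ 0 → u ∈ S) :
    restrict (P : Set _) (f * g) = restrict P f * restrict P g := by
  classical
  refine biCoeff_ext fun u => ?_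
  rw [biCoeff_mul, biCoeff_restrict, biCoeff_mul]
  -- Termwise comparison: the face condition settles sums inside `P`, and closure of `P` under
  -- addition settles sums outside.
  have key : ∀ v w, v + w = u → biCoeff (restrict (P : Set _) f) v * biCoeff (restrict P g) w =
      if u ∈ P then biCoeff f v * biCoeff g w else 0 := by
    rintro v w rfl
    simp only [biCoeff_restrict, SetLike.mem_coe]
    by_cases hv : biCoeff f v = 0
    · simp [hv]
    by_cases hw : biCoeff g w = 0
    · simp [hw]
    by_cases h : v + w ∈ P
    · obtain ⟨h1, h2⟩ := hP v (hf v hv) w (hg w hw) h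
      simp [h, h1, h2]
    · by_cases h1 : v ∈ P
      · by_cases h2 : w ∈ P
        · exact absurd (add_mem h1 h2) h
        · simp [h, h2]
      · simp [h, h1]
  have : ∀ x ∈ Finset.HasAntidiagonal.antidiagonal u.1,
      ∀ y ∈ Finset.HasAntidiagonal.antidiagonal u.2,
      biCoeff (restrict (P : Set _) f) (x.1, y.1) * biCoeff (restrict P g) (x.2, y.2) =
      if u ∈ P then biCoeff f (x.1, y.1) * biCoeff g (x.2, y.2) else 0 := fun x hx y hy =>
    key _ _ <| Prod.ext (Finset.HasAntidiagonal.mem_antidiagonal.1 hx)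
      (Finset.HasAntidiagonal.mem_antidiagonal.1 hy)
  rw [Finset.sum_congr rfl fun x hx => Finset.sum_congr rfl (this x hx)]
  by_cases h : u ∈ P <;> simp [h]

end Bidegree

/-! ### The monoids of bidegrees of the rings `K[F]` and of the Rees ring. -/

section Monoids

variable (J : Ideal (MvPolynomial (Fin n) K))

/-- The monoid of the bidegrees of the monomials in `K[F]`. -/
def genMonoid (F : Set (Fin n → ℝ)) : AddSubmonoid (ℕ × (Fin n →₀ ℕ)) :=
  AddSubmonoid.closure ((fun a => (1, a)) '' faceGens J F)

/-- The monoid of the bidegrees of the monomials in the Rees ring of a monomial ideal. -/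
def reesMonoid : AddSubmonoid (ℕ × (Fin n →₀ ℕ)) where
  carrier := {u | ∃ c ≤ u.2, (u.1, c) ∈ genMonoid J Set.univ}
  zero_mem' := ⟨0, le_rfl, zero_mem _⟩
  add_mem' := by
    rintro u v ⟨c, hc, h⟩ ⟨d, hd, h'⟩
    exact ⟨c + d, add_le_add hc hd, add_mem h h'⟩

variable {J}

theorem genMonoid_mono {F G : Set (Fin n → ℝ)} (h : faceGens J G ⊆ faceGens J F) :
    genMonoid J G ≤ genMonoid J F :=
  AddSubmonoid.closure_mono (Set.image_mono h)

theorem faceGens_mono {F G : Set (Fin n → ℝ)} (h : G ⊆ F) : faceGens J G ⊆ faceGens J F :=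
  fun _ ha => ⟨ha.1, h ha.2⟩

theorem genMonoid_le_reesMonoid (F : Set (Fin n → ℝ)) : genMonoid J F ≤ reesMonoid J :=
  fun u hu => ⟨u.2, le_rfl, genMonoid_mono (faceGens_mono (Set.subset_univ F)) hu⟩

theorem genMonoid_fst_zero {F : Set (Fin n → ℝ)} {u : ℕ × (Fin n →₀ ℕ)} (hu : u ∈ genMonoid J F)
    (h : u.1 = 0) : u = 0 := by
  induction hu using AddSubmonoid.closure_induction with
  | mem x hx => obtain ⟨a, _, rfl⟩ := hx; simp at h
  | zero => rfl
  | add x y _ _ hx hy =>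
    simp only [Prod.fst_add, Nat.add_eq_zero_iff] at h
    rw [hx h.1, hy h.2, add_zero]

/-- The first coordinate counts the generators used, so in degree one there is exactly one. This
recovers the generators of a face from its monoid. -/
theorem genMonoid_fst_one {F : Set (Fin n → ℝ)} {u : ℕ × (Fin n →₀ ℕ)} (hu : u ∈ genMonoid J F)
    (h : u.1 = 1) : u.2 ∈ faceGens J F := by
  induction hu using AddSubmonoid.closure_induction with
  | mem x hx => obtain ⟨a, ha, rfl⟩ := hx; exact ha
  | zero => simp at h
  | add x y hx' hy' hx hy =>
    rw [Prod.fst_add, Nat.add_eq_one_iff] at h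
    rcases h with ⟨h1, h2⟩ | ⟨h1, h2⟩
    · rw [genMonoid_fst_zero hx' h1, zero_add]
      exact hy h2
    · rw [genMonoid_fst_zero hy' h2, add_zero]
      exact hx h1

theorem mem_exponents_of_le {a b : Fin n →₀ ℕ} (ha : a ∈ exponents J) (h : a ≤ b) :
    b ∈ exponents J := by
  obtain ⟨c, rfl⟩ := exists_add_of_le h
  have := J.mul_mem_right (MvPolynomial.monomial c 1) ha
  rwa [MvPolynomial.monomial_mul, mul_one] at this

theorem exists_minGens_le {b : Fin n →₀ ℕ} (hb : b ∈ exponents J) : ∃ a ≤ b, a ∈ minGens J :=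
  exists_minimal_le_of_wellFoundedLT (· ∈ exponents J) b hb

variable (J) in
theorem finite_minGens : (minGens J).Finite :=
  WellQuasiOrderedLE.finite_of_isAntichain (setOfPred_minimal_antichain _)

theorem mem_exponents_of_coeff_ne_zero (hJ : IsMonomialIdeal J) {f : MvPolynomial (Fin n) K}
    (hf : f ∈ J) {b : Fin n →₀ ℕ} (hb : f.coeff b ≠ 0) : b ∈ exponents J := by
  obtain ⟨S, rfl⟩ := hJ
  obtain ⟨a, ha, hab⟩ :=
    MvPolynomial.mem_ideal_span_monomial_image.1 hf b (MvPolynomial.mem_support_iff.2 hb)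
  exact mem_exponents_of_le (Ideal.subset_span ⟨a, ha, rfl⟩) hab

/-- Each factor from `J` contributes a minimal generator below its exponent; the surplus is absorbed
by the upward closure built into `reesMonoid`. -/
theorem mem_reesMonoid_of_mem_pow (hJ : IsMonomialIdeal J) (k : ℕ) {f : MvPolynomial (Fin n) K}
    (hf : f ∈ J ^ k) {b : Fin n →₀ ℕ} (hb : f.coeff b ≠ 0) : (k, b) ∈ reesMonoid J := by
  classical
  induction k generalizing f b with
  | zero => exact ⟨0, zero_le, zero_mem _⟩
  | succ k ih =>
    rw [pow_succ] at hf
    induction hf using Submodule.mul_induction_on' generalizing b with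
    | mem_mul_mem g hg h hh =>
      obtain ⟨c, hc, d, hd, rfl⟩ := Finset.mem_add.1
        (MvPolynomial.support_mul g h (MvPolynomial.mem_support_iff.2 hb))
      obtain ⟨a, ha, ha'⟩ := exists_minGens_le
        (mem_exponents_of_coeff_ne_zero hJ hh (MvPolynomial.mem_support_iff.1 hd))
      have h1 : ((1, d) : ℕ × (Fin n →₀ ℕ)) ∈ reesMonoid J :=
        ⟨a, ha, AddSubmonoid.subset_closure ⟨a, ⟨ha', trivial⟩, rfl⟩⟩
      exact add_mem (ih hg (MvPolynomial.mem_support_iff.1 hc)) h1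
    | add g _ h _ hg hh =>
      rw [MvPolynomial.coeff_add] at hb
      by_cases hgb : g.coeff b = 0
      · exact hh fun hhb => hb (by rw [hgb, hhb, add_zero])
      · exact hg hgb

theorem mem_reesMonoid_of_biCoeff_ne_zero (hJ : IsMonomialIdeal J)
    {f : Polynomial (MvPolynomial (Fin n) K)} (hf : f ∈ reesAlgebra J) (u : ℕ × (Fin n →₀ ℕ))
    (hu : biCoeff f u ≠ 0) : u ∈ reesMonoid J :=
  mem_reesMonoid_of_mem_pow hJ u.1 (hf u.1) hu

theorem biMonomial_mem_faceRing {F : Set (Fin n → ℝ)} {u : ℕ × (Fin n →₀ ℕ)}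
    (hu : u ∈ genMonoid J F) (c : K) : biMonomial u c ∈ faceRing J F := by
  rw [← mul_one c, ← smul_biMonomial]
  refine Subalgebra.smul_mem _ ?_ c
  induction hu using AddSubmonoid.closure_induction with
  | mem x hx =>
    obtain ⟨a, ha, rfl⟩ := hx
    exact Algebra.subset_adjoin ⟨a, ha, rfl⟩
  | zero => rw [biMonomial_zero_one]; exact one_mem _
  | add x y _ _ hx hy =>
    rw [← one_mul (1 : K), ← biMonomial_mul]
    exact mul_mem hx hy

theorem faceRing_le_reesAlgebra (F : Set (Fin n → ℝ)) :
    faceRing J F ≤ (reesAlgebra J).restrictScalars K := by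
  refine Algebra.adjoin_le ?_
  rintro _ ⟨a, ha, rfl⟩
  refine reesAlgebra.monomial_mem.2 ?_
  rw [pow_one]
  exact ha.1.prop

theorem biMonomial_mem_reesAlgebra {u : ℕ × (Fin n →₀ ℕ)} (hu : u ∈ reesMonoid J) (c : K) :
    biMonomial u c ∈ reesAlgebra J := by
  obtain ⟨d, hd, h⟩ := hu
  obtain ⟨e, he⟩ := exists_add_of_le hd
  have h1 : biMonomial (u.1, d) c ∈ reesAlgebra J :=
    faceRing_le_reesAlgebra _ (biMonomial_mem_faceRing h c)
  have h2 : biMonomial (0, e) (1 : K) ∈ reesAlgebra J := by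
    refine reesAlgebra.monomial_mem.2 ?_
    simp
  have := mul_mem h1 h2
  rw [biMonomial_mul, mul_one] at this
  convert this
  exact Prod.ext (by simp) he

/-- Together with `mem_faceRing_of_biCoeff`, this allows membership in `K[F]` to be tested on
supports alone. -/
theorem biCoeff_eq_zero_of_mem_faceRing {F : Set (Fin n → ℝ)}
    {f : Polynomial (MvPolynomial (Fin n) K)} (hf : f ∈ faceRing J F) {u : ℕ × (Fin n →₀ ℕ)}
    (hu : u ∉ genMonoid J F) : biCoeff f u = 0 := by
  classical
  induction hf using Algebra.adjoin_induction generalizing u with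
  | mem x hx =>
    obtain ⟨a, ha, rfl⟩ := hx
    have : ((1, a) : ℕ × (Fin n →₀ ℕ)) ∈ genMonoid J F :=
      AddSubmonoid.subset_closure ⟨a, ha, rfl⟩
    change biCoeff (biMonomial (1, a) 1) u = 0
    rw [biCoeff_biMonomial, if_neg]
    rintro rfl
    exact hu this
  | algebraMap c =>
    rw [algebraMap_eq_biMonomial, biCoeff_biMonomial, if_neg]
    rintro rfl
    exact hu (zero_mem _)
  | add f g _ _ hf hg => rw [biCoeff_add, hf hu, hg hu, add_zero]
  | mul f g _ _ hf hg =>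
    rw [biCoeff_mul]
    refine Finset.sum_eq_zero fun x hx => Finset.sum_eq_zero fun y hy => ?_
    by_cases h : (x.1, y.1) ∈ genMonoid J F
    · rw [hg, mul_zero]
      intro h'
      refine hu ?_
      convert add_mem h h'
      exact Prod.ext (Finset.HasAntidiagonal.mem_antidiagonal.1 hx).symm
        (Finset.HasAntidiagonal.mem_antidiagonal.1 hy).symm
    · rw [hf h, zero_mul]

theorem mem_faceRing_of_biCoeff {F : Set (Fin n → ℝ)} {f : Polynomial (MvPolynomial (Fin n) K)}
    (hf : ∀ u, biCoeff f u ≠ 0 → u ∈ genMonoid J F) : f ∈ faceRing J F := by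
  rw [eq_sum_biMonomial f]
  exact sum_mem fun u hu => biMonomial_mem_faceRing (hf u (by simpa using hu)) _

theorem mem_reesAlgebra_of_biCoeff {f : Polynomial (MvPolynomial (Fin n) K)}
    (hf : ∀ u, biCoeff f u ≠ 0 → u ∈ reesMonoid J) : f ∈ reesAlgebra J := by
  rw [eq_sum_biMonomial f]
  exact sum_mem fun u hu => biMonomial_mem_reesAlgebra (hf u (by simpa using hu)) _

end Monoids

/-! ### Compact faces of the Newton polyhedron and positive weights. -/

section Faces

/-- The linear form on `ℝⁿ` with coefficient vector `w`. -/
def dot (w : Fin n → ℝ) : (Fin n → ℝ) →L[ℝ] ℝ := ∑ i, w i • ContinuousLinearMap.proj i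

theorem dot_apply (w x : Fin n → ℝ) : dot w x = ∑ i, w i * x i := by simp [dot]

theorem toReal_add (a b : Fin n →₀ ℕ) : toReal (a + b) = toReal a + toReal b := by
  ext; simp [toReal]

theorem toReal_zero : toReal (0 : Fin n →₀ ℕ) = 0 := by ext; simp [toReal]

theorem toReal_single (i : Fin n) (m : ℕ) :
    toReal (Finsupp.single i m) = Pi.single i (m : ℝ) := by
  classical
  ext j
  by_cases h : i = j
  · subst h; simp [toReal]
  · simp [toReal, Ne.symm h]

theorem dot_toReal_pos {w : Fin n → ℝ} (hw : ∀ i, 0 < w i) {a : Fin n →₀ ℕ} (ha : a ≠ 0) :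
    0 < dot w (toReal a) := by
  obtain ⟨i, hi⟩ := Finsupp.ne_iff.1 ha
  rw [dot_apply]
  refine Finset.sum_pos' (fun j _ => mul_nonneg (hw j).le (Nat.cast_nonneg _))
    ⟨i, Finset.mem_univ _, mul_pos (hw i) ?_⟩
  exact Nat.cast_pos.2 (Nat.pos_of_ne_zero hi)

theorem dot_toReal_lt {w : Fin n → ℝ} (hw : ∀ i, 0 < w i) {a b : Fin n →₀ ℕ} (h : a < b) :
    dot w (toReal a) < dot w (toReal b) := by
  obtain ⟨c, rfl⟩ := exists_add_of_le h.le
  rw [toReal_add, map_add, lt_add_iff_pos_right]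
  refine dot_toReal_pos hw ?_
  rintro rfl
  simp at h

theorem dot_toReal_le {w : Fin n → ℝ} (hw : ∀ i, 0 < w i) {a b : Fin n →₀ ℕ} (h : a ≤ b) :
    dot w (toReal a) ≤ dot w (toReal b) := by
  rcases h.eq_or_lt with rfl | h
  exacts [le_rfl, (dot_toReal_lt hw h).le]

variable (J : Ideal (MvPolynomial (Fin n) K))

/-- The face of `conv(J)` on which the linear form with coefficient vector `w` is minimal. -/
def weightFace (w : Fin n → ℝ) : Set (Fin n → ℝ) :=
  {x ∈ newton J | ∀ y ∈ newton J, dot w x ≤ dot w y}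

theorem isExposed_weightFace (w : Fin n → ℝ) : IsExposed ℝ (newton J) (weightFace J w) :=
  fun _ => ⟨-dot w, by simp [weightFace]⟩

variable {J}

theorem toReal_mem_newton {a : Fin n →₀ ℕ} (ha : a ∈ minGens J) : toReal a ∈ newton J :=
  subset_convexHull _ _ ⟨a, ha.prop, rfl⟩

theorem exists_minimizer (hne : (minGens J).Nonempty) (w : Fin n → ℝ) :
    ∃ a ∈ minGens J, ∀ b ∈ minGens J, dot w (toReal a) ≤ dot w (toReal b) :=
  Set.exists_min_image _ _ (finite_minGens J) hne

/-- The bound and the description of its equality case are proved jointly because together they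
define a convex set; it then suffices to check exponents of monomials in `J`. There, positivity of
`w` makes any exponent strictly above a generator strictly heavier. -/
theorem newton_weight {w : Fin n → ℝ} (hw : ∀ i, 0 < w i) {a : Fin n →₀ ℕ}
    (hmin : ∀ b ∈ minGens J, dot w (toReal a) ≤ dot w (toReal b))
    {x : Fin n → ℝ} (hx : x ∈ newton J) :
    dot w (toReal a) ≤ dot w x ∧ (dot w x = dot w (toReal a) →
      x ∈ convexHull ℝ (toReal '' {b ∈ minGens J | dot w (toReal b) = dot w (toReal a)})) := by
  set T := convexHull ℝ (toReal '' {b ∈ minGens J | dot w (toReal b) = dot w (toReal a)})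
  have hconv : Convex ℝ {x | dot w (toReal a) ≤ dot w x ∧ (dot w x = dot w (toReal a) → x ∈ T)} := by
    rintro x ⟨hx, hx'⟩ y ⟨hy, hy'⟩ s t hs ht hst
    have hle : dot w (toReal a) = s * dot w (toReal a) + t * dot w (toReal a) := by
      rw [← add_mul, hst, one_mul]
    have h1 := mul_le_mul_of_nonneg_left hx hs
    have h2 := mul_le_mul_of_nonneg_left hy ht
    have hval : dot w (s • x + t • y) = s * dot w x + t * dot w y := by simp
    refine ⟨by rw [hval]; linarith, fun h => ?_⟩
    rw [hval] at h
    rcases hs.eq_or_lt with rfl | hs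
    · obtain rfl : t = 1 := by linarith
      simpa using hy' (by linarith)
    rcases ht.eq_or_lt with rfl | ht
    · obtain rfl : s = 1 := by linarith
      simpa using hx' (by linarith)
    refine convex_convexHull ℝ _ (hx' ?_) (hy' ?_) hs.le ht.le hst
    · exact mul_left_cancel₀ hs.ne' (by linarith)
    · exact mul_left_cancel₀ ht.ne' (by linarith)
  refine convexHull_min ?_ hconv hx
  rintro _ ⟨b, hb, rfl⟩
  obtain ⟨c, hcb, hc⟩ := exists_minGens_le hb
  have h1 := hmin c hc
  refine ⟨h1.trans (dot_toReal_le hw hcb), fun h => ?_⟩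
  rcases hcb.eq_or_lt with rfl | hlt
  · exact subset_convexHull _ _ ⟨c, ⟨hc, h⟩, rfl⟩
  · exact absurd (dot_toReal_lt hw hlt) (by linarith)

theorem weightFace_eq_convexHull {w : Fin n → ℝ} (hw : ∀ i, 0 < w i) {a : Fin n →₀ ℕ}
    (ha : a ∈ minGens J) (hmin : ∀ b ∈ minGens J, dot w (toReal a) ≤ dot w (toReal b)) :
    weightFace J w =
      convexHull ℝ (toReal '' {b ∈ minGens J | dot w (toReal b) = dot w (toReal a)}) := by
  refine Set.Subset.antisymm (fun x hx => (newton_weight hw hmin hx.1).2 (le_antisymm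
    (hx.2 _ (toReal_mem_newton ha)) (newton_weight hw hmin hx.1).1)) ?_
  refine convexHull_min ?_ ((isExposed_weightFace J w).convex (convex_convexHull ℝ _))
  rintro _ ⟨b, ⟨hb, hba⟩, rfl⟩
  exact ⟨toReal_mem_newton hb, fun y hy => hba.trans_le (newton_weight hw hmin hy).1⟩

theorem isCompact_weightFace (hne : (minGens J).Nonempty) {w : Fin n → ℝ} (hw : ∀ i, 0 < w i) :
    IsCompact (weightFace J w) := by
  obtain ⟨a, ha, hmin⟩ := exists_minimizer hne w
  rw [weightFace_eq_convexHull hw ha hmin]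
  exact Set.Finite.isCompact_convexHull ℝ
    (((finite_minGens J).subset (Set.sep_subset _ _)).image toReal)

theorem toReal_mem_weightFace {w : Fin n → ℝ} (hw : ∀ i, 0 < w i) {a b : Fin n →₀ ℕ}
    (ha : a ∈ minGens J) (hmin : ∀ b ∈ minGens J, dot w (toReal a) ≤ dot w (toReal b))
    (hb : b ∈ minGens J) :
    toReal b ∈ weightFace J w ↔ dot w (toReal b) = dot w (toReal a) :=
  ⟨fun h => le_antisymm (h.2 _ (toReal_mem_newton ha)) (hmin b hb), fun h =>
    ⟨toReal_mem_newton hb, fun _ hy => h.trans_le (newton_weight hw hmin hy).1⟩⟩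

theorem add_single_mem_newton {x : Fin n → ℝ} (hx : x ∈ newton J) (i : Fin n) (m : ℕ) :
    Pi.single i (m : ℝ) + x ∈ newton J := by
  have hconv := (convex_convexHull ℝ (toReal '' exponents J)).translate_preimage_right
    (Pi.single i (m : ℝ))
  refine convexHull_min ?_ hconv hx
  rintro _ ⟨a, ha, rfl⟩
  refine subset_convexHull _ _ ⟨Finsupp.single i m + a, mem_exponents_of_le ha le_add_self, ?_⟩
  rw [toReal_add, toReal_single]

theorem minGens_nonempty_of_newton {x : Fin n → ℝ} (hx : x ∈ newton J) :
    (minGens J).Nonempty := by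
  obtain ⟨_, b, hb, rfl⟩ := convexHull_nonempty_iff.1 ⟨x, hx⟩
  obtain ⟨a, -, ha⟩ := exists_minGens_le hb
  exact ⟨a, ha⟩

/-- Every nonempty compact face of the Newton polyhedron is cut out by a strictly positive
weight. -/
theorem exists_weightFace_eq (F : CompactFace J) (hF : F.1.Nonempty) :
    ∃ w : Fin n → ℝ, (∀ i, 0 < w i) ∧ F.1 = weightFace J w := by
  classical
  obtain ⟨l, hl⟩ := F.2.1 hF
  obtain ⟨x, hx⟩ := hF
  have hlw : ∀ y, l y = -dot (fun i => -l (Pi.single i 1)) y := fun y => by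
    conv_lhs => rw [← Finset.univ_sum_single y]
    rw [map_sum, dot_apply, ← Finset.sum_neg_distrib]
    refine Finset.sum_congr rfl fun i _ => ?_
    rw [neg_mul, neg_neg, mul_comm, ← smul_eq_mul, ← map_smul, ← Pi.single_smul, smul_eq_mul,
      mul_one]
  refine ⟨fun i => -l (Pi.single i 1), fun i => ?_, ?_⟩
  · rw [hl] at hx
    have hsingle : ∀ m : ℕ, l (Pi.single i (m : ℝ)) = m * l (Pi.single i 1) := fun m => by
      rw [← smul_eq_mul, ← map_smul, ← Pi.single_smul, smul_eq_mul, mul_one]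
    have hle := hx.2 _ (add_single_mem_newton hx.1 i 1)
    rw [map_add, hsingle, Nat.cast_one, one_mul] at hle
    rcases (show l (Pi.single i 1) ≤ 0 by linarith).lt_or_eq with h | h
    · linarith
    -- If `l` vanished on the `i`-th unit vector, `F` would contain unboundedly many translates of
    -- `x` in that direction, contradicting compactness.
    · obtain ⟨C, hC⟩ := F.2.2.bddAbove_image (f := fun y => y i) (by fun_prop)
      obtain ⟨m, hm⟩ := exists_nat_gt (C - x i)
      have hmem : Pi.single i (m : ℝ) + x ∈ F.1 := by
        rw [hl]
        refine ⟨add_single_mem_newton hx.1 i m, fun y hy => ?_⟩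
        rw [map_add, hsingle, h, mul_zero, zero_add]
        exact hx.2 y hy
      have := hC ⟨_, hmem, rfl⟩
      simp only [Pi.add_apply, Pi.single_eq_same] at this
      linarith
  · rw [hl]
    ext y
    refine and_congr_right fun _ => forall₂_congr fun z _ => ?_
    rw [hlw z, hlw y, neg_le_neg_iff]

/-- On the Rees monoid, the bidegrees of the monomials of `K[F]` are those of minimal weight. -/
theorem genMonoid_weightFace {w : Fin n → ℝ} (hw : ∀ i, 0 < w i) {a : Fin n →₀ ℕ}
    (ha : a ∈ minGens J) (hmin : ∀ b ∈ minGens J, dot w (toReal a) ≤ dot w (toReal b))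
    {u : ℕ × (Fin n →₀ ℕ)} (hu : u ∈ reesMonoid J) :
    u.1 * dot w (toReal a) ≤ dot w (toReal u.2) ∧
      (dot w (toReal u.2) = u.1 * dot w (toReal a) ↔ u ∈ genMonoid J (weightFace J w)) := by
  have h1 : ∀ v ∈ genMonoid J Set.univ, v.1 * dot w (toReal a) ≤ dot w (toReal v.2) ∧
      (dot w (toReal v.2) = v.1 * dot w (toReal a) → v ∈ genMonoid J (weightFace J w)) := by
    intro v hv
    induction hv using AddSubmonoid.closure_induction with
    | mem x hx =>
      obtain ⟨b, hb, rfl⟩ := hx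
      simp only [Nat.cast_one, one_mul]
      exact ⟨hmin b hb.1, fun h => AddSubmonoid.subset_closure
        ⟨b, ⟨hb.1, (toReal_mem_weightFace hw ha hmin hb.1).2 h⟩, rfl⟩⟩
    | zero => exact ⟨by simp [toReal_zero], fun _ => zero_mem _⟩
    | add x y _ _ hx hy =>
      simp only [Prod.fst_add, Prod.snd_add, toReal_add, map_add, Nat.cast_add, add_mul]
      exact ⟨add_le_add hx.1 hy.1, fun h => add_mem (hx.2 (by linarith [hx.1, hy.1]))
        (hy.2 (by linarith [hx.1, hy.1]))⟩
  have h2 : ∀ v ∈ genMonoid J (weightFace J w), dot w (toReal v.2) = v.1 * dot w (toReal a) := by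
    intro v hv
    induction hv using AddSubmonoid.closure_induction with
    | mem x hx =>
      obtain ⟨b, hb, rfl⟩ := hx
      simpa using (toReal_mem_weightFace hw ha hmin hb.1).1 hb.2
    | zero => simp [toReal_zero]
    | add x y _ _ hx hy =>
      simp only [Prod.fst_add, Prod.snd_add, toReal_add, map_add, Nat.cast_add, add_mul, hx, hy]
  obtain ⟨c, hc, hcu⟩ := hu
  have h3 := h1 _ hcu
  refine ⟨h3.1.trans (dot_toReal_le hw hc), fun h => ?_, h2 u⟩
  -- An exponent strictly above the product of generators has strictly larger weight, so minimal
  -- weight leaves no surplus.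
  rcases hc.eq_or_lt with rfl | hlt
  · exact h3.2 h
  · have := dot_toReal_lt hw hlt
    exact absurd h3.1 (by simp only; linarith)

/-- The bidegrees of the monomials of `K[F]` form a face of the Rees monoid. -/
theorem mem_genMonoid_of_add_mem (F : CompactFace J) {u v : ℕ × (Fin n →₀ ℕ)}
    (hu : u ∈ reesMonoid J) (hv : v ∈ reesMonoid J) (h : u + v ∈ genMonoid J F.1) :
    u ∈ genMonoid J F.1 ∧ v ∈ genMonoid J F.1 := by
  by_cases hF : F.1.Nonempty
  · obtain ⟨w, hw, hFw⟩ := exists_weightFace_eq F hF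
    obtain ⟨a, ha, hmin⟩ := exists_minimizer
      (minGens_nonempty_of_newton (F.2.1.subset hF.some_mem)) w
    rw [hFw] at h ⊢
    have h1 := genMonoid_weightFace hw ha hmin hu
    have h2 := genMonoid_weightFace hw ha hmin hv
    have h3 := (genMonoid_weightFace hw ha hmin (add_mem hu hv)).2.2 h
    simp only [Prod.fst_add, Prod.snd_add, toReal_add, map_add, Nat.cast_add, add_mul] at h3
    exact ⟨h1.2.1 (by linarith [h1.1, h2.1]), h2.2.1 (by linarith [h1.1, h2.1])⟩
  · have hbot : genMonoid J F.1 = ⊥ := by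
      rw [Set.not_nonempty_iff_eq_empty] at hF
      have : faceGens J F.1 = ∅ := by ext; simp [faceGens, hF]
      rw [genMonoid, this, Set.image_empty, AddSubmonoid.closure_empty]
    rw [hbot, AddSubmonoid.mem_bot] at h ⊢
    rw [AddSubmonoid.mem_bot]
    have h1 : u.1 + v.1 = 0 := congrArg Prod.fst h
    have h2 : u.2 + v.2 = 0 := congrArg Prod.snd h
    rw [add_eq_zero] at h1 h2
    exact ⟨Prod.ext h1.1 h2.1, Prod.ext h1.2 h2.2⟩

theorem faceGens_nonempty_of_mem {F : Set (Fin n → ℝ)} {u : ℕ × (Fin n →₀ ℕ)}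
    (hu : u ∈ genMonoid J F) (h : u ≠ 0) : (faceGens J F).Nonempty := by
  by_contra hne
  rw [Set.not_nonempty_iff_eq_empty] at hne
  rw [genMonoid, hne, Set.image_empty, AddSubmonoid.closure_empty, AddSubmonoid.mem_bot] at hu
  exact h hu

/-- Write the bidegree as a sum of generators of `F`. Since the monoid of `G` is a face of the Rees
monoid, every summand lies in it, hence is a generator of both faces. -/
theorem genMonoid_inter (F G : CompactFace J) {u : ℕ × (Fin n →₀ ℕ)}
    (hF : u ∈ genMonoid J F.1) (hG : u ∈ genMonoid J G.1) : u ∈ genMonoid J (F.1 ∩ G.1) := by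
  induction hF using AddSubmonoid.closure_induction with
  | mem x hx =>
    obtain ⟨a, ha, rfl⟩ := hx
    exact AddSubmonoid.subset_closure ⟨a, ⟨ha.1, ha.2, (genMonoid_fst_one hG rfl).2⟩, rfl⟩
  | zero => exact zero_mem _
  | add x y hx' hy' hx hy =>
    obtain ⟨h1, h2⟩ := mem_genMonoid_of_add_mem G (genMonoid_le_reesMonoid _ hx')
      (genMonoid_le_reesMonoid _ hy') hG
    exact add_mem (hx h1) (hy h2)

/-- A bidegree of the Rees monoid that lies over no compact face has a multiple that is not
minimal. -/
theorem exists_nsmul_eq_add_single {u : ℕ × (Fin n →₀ ℕ)} (hu : u ∈ reesMonoid J) (hu0 : u ≠ 0)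
    (h : ∀ w : Fin n → ℝ, (∀ i, 0 < w i) → u ∉ genMonoid J (weightFace J w)) :
    ∃ (N : ℕ) (i : Fin n), ∃ v ∈ reesMonoid J, N • u = (0, Finsupp.single i 1) + v := by
  obtain ⟨k, b⟩ := u
  rcases Nat.eq_zero_or_pos k with rfl | hk
  · have hb : b ≠ 0 := fun hb => hu0 (by rw [hb]; rfl)
    obtain ⟨i, hi⟩ := Finsupp.ne_iff.1 hb
    have hle : Finsupp.single i 1 ≤ b := by
      rw [Finsupp.single_le_iff]
      exact Nat.one_le_iff_ne_zero.2 hi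
    obtain ⟨c, rfl⟩ := exists_add_of_le hle
    exact ⟨1, i, (0, c), ⟨0, zero_le, zero_mem _⟩, by simp⟩
  obtain ⟨d, hdb, hd⟩ := id hu
  have hne : (minGens J).Nonempty :=
    (faceGens_nonempty_of_mem hd fun h0 => hk.ne' (congrArg Prod.fst h0)).mono fun _ h => h.1
  have := (finite_minGens J).fintype
  -- A weight nonnegative on all `k a - b` would place `u` on a compact face. The alternative is a
  -- combination `∑ m a (k a - b)` that is nonpositive, and negative at some `i`.
  rcases exists_pos_weight_or (fun (a : minGens J) i => (k : ℤ) * (a.1 i : ℤ) - b i) with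
    ⟨w, hw, hwv⟩ | ⟨m, hm, i, hi⟩
  · exfalso
    obtain ⟨a, ha, hmin⟩ := exists_minimizer hne w
    have h1 := genMonoid_weightFace hw ha hmin hu
    refine h w hw (h1.2.1 (le_antisymm ?_ h1.1))
    have h2 := hwv ⟨a, ha⟩
    simp only [dot_apply, Finset.mul_sum, toReal]
    rw [← sub_nonneg, ← Finset.sum_sub_distrib]
    refine h2.trans_eq (Finset.sum_congr rfl fun j _ => ?_)
    push_cast
    ring
  · have hsum : ∀ j, (∑ a, (m a : ℤ) * ((k : ℤ) * (a.1 j : ℤ) - b j)) =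
        (((k • ∑ a, m a • a.1) j : ℕ) : ℤ) - ((((∑ a, m a) • b) j : ℕ) : ℤ) := fun j => by
      simp only [Finsupp.smul_apply, Finsupp.finsetSum_apply, smul_eq_mul]
      push_cast
      rw [Finset.mul_sum, Finset.sum_mul, ← Finset.sum_sub_distrib]
      exact Finset.sum_congr rfl fun a _ => by ring
    simp only [hsum] at hm hi
    have hle : k • ∑ a, m a • a.1 + Finsupp.single i 1 ≤ (∑ a, m a) • b := fun j => by
      have := hm j
      rw [Finsupp.add_apply]
      by_cases hij : i = j
      · subst hij
        rw [Finsupp.single_eq_same]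
        omega
      · rw [Finsupp.single_apply, if_neg hij]
        omega
    obtain ⟨c, hc⟩ := exists_add_of_le hle
    -- Strictness at `i` leaves room to split off one variable; what remains lies above `k` times
    -- the bidegree of a product of generators, in the right `t`-degree.
    refine ⟨∑ a, m a, i, (k * ∑ a, m a, k • ∑ a, m a • a.1 + c),
      ?_, Prod.ext ?_ ?_⟩
    · have : ((∑ a, m a, ∑ a, m a • a.1) : ℕ × (Fin n →₀ ℕ)) =
          ∑ a : minGens J, m a • ((1, a.1) : ℕ × (Fin n →₀ ℕ)) := by
        refine Prod.ext ?_ ?_ <;> simp [Prod.fst_sum, Prod.snd_sum]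
      have hmem : ((∑ a, m a, ∑ a, m a • a.1) : ℕ × (Fin n →₀ ℕ)) ∈ genMonoid J Set.univ := by
        rw [this]
        refine sum_mem fun a _ => nsmul_mem (AddSubmonoid.subset_closure ?_) _
        exact ⟨a.1, ⟨a.2, trivial⟩, rfl⟩
      exact ⟨_, le_self_add, nsmul_mem hmem k⟩
    · simp [mul_comm]
    · simp only [Prod.smul_mk, Prod.mk_add_mk, hc]
      abel

end Faces

/-! ### The truncation homomorphisms and the map to the inverse limit. -/

section Truncation

variable {J : Ideal (MvPolynomial (Fin n) K)}

theorem restrict_mem_faceRing (F : Set (Fin n → ℝ)) (f : Polynomial (MvPolynomial (Fin n) K)) :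
    restrict (genMonoid J F) f ∈ faceRing J F := by
  classical
  refine mem_faceRing_of_biCoeff fun u hu => ?_
  rw [biCoeff_restrict] at hu
  exact (ite_ne_right_iff.1 hu).1

theorem restrict_algebraMap (P : AddSubmonoid (ℕ × (Fin n →₀ ℕ))) (c : K) :
    restrict (P : Set (ℕ × (Fin n →₀ ℕ))) (algebraMap K _ c) =
      algebraMap K (Polynomial (MvPolynomial (Fin n) K)) c := by
  classical
  refine biCoeff_ext fun u => ?_
  rw [biCoeff_restrict, algebraMap_eq_biMonomial, biCoeff_biMonomial]
  by_cases hu : 0 = u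
  · subst hu; simp
  · simp [hu]

/-- The homomorphism `R(J) → K[F]` which forgets the monomials outside of `K[F]`. -/
def toFaceRing (hJ : IsMonomialIdeal J) (F : CompactFace J) :
    reesAlgebra J →ₐ[K] faceRing J F.1 where
  toFun f := ⟨restrict (genMonoid J F.1) f.1, restrict_mem_faceRing F.1 f.1⟩
  map_one' := Subtype.ext <| by
    have := restrict_algebraMap (genMonoid J F.1) (1 : K)
    rwa [map_one] at this
  map_mul' f g := Subtype.ext <|
    restrict_mul (fun _ hu _ hv h => mem_genMonoid_of_add_mem F hu hv h)
      (mem_reesMonoid_of_biCoeff_ne_zero hJ f.2) (mem_reesMonoid_of_biCoeff_ne_zero hJ g.2)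
  map_zero' := Subtype.ext <| by
    have := restrict_algebraMap (genMonoid J F.1) (0 : K)
    rwa [map_zero] at this
  map_add' f g := Subtype.ext <| biCoeff_ext fun u => by
    classical
    simp only [AddMemClass.mk_add_mk, AddMemClass.coe_add, biCoeff_add, biCoeff_restrict]
    split_ifs <;> simp
  commutes' c := Subtype.ext <| restrict_algebraMap _ c

open Classical in
theorem biCoeff_toFaceRing (hJ : IsMonomialIdeal J) (F : CompactFace J) (f : reesAlgebra J)
    (u : ℕ × (Fin n →₀ ℕ)) : biCoeff (toFaceRing hJ F f).1 u =
      if u ∈ genMonoid J F.1 then biCoeff f.1 u else 0 :=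
  biCoeff_restrict _ _ _

/-- The inclusion of `K[F]` in the Rees ring. -/
def faceRingInclusion (F : Set (Fin n → ℝ)) : faceRing J F →ₐ[K] reesAlgebra J where
  toFun f := ⟨f.1, faceRing_le_reesAlgebra F f.2⟩
  map_one' := rfl
  map_mul' _ _ := rfl
  map_zero' := rfl
  map_add' _ _ := rfl
  commutes' _ := rfl

theorem faceRing_algHom_ext {B : Type*} [Semiring B] [Algebra K B] {F : Set (Fin n → ℝ)}
    {φ ψ : faceRing J F →ₐ[K] B} (h : ∀ a, φ (faceGen J F a) = ψ (faceGen J F a)) : φ = ψ := by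
  have : φ.comp (present J F) = ψ.comp (present J F) :=
    MvPolynomial.algHom_ext fun a => by simpa [present] using h a
  refine AlgHom.ext fun x => ?_
  obtain ⟨q, rfl⟩ := present_surjective J F x
  exact DFunLike.congr_fun this q

/-- On generators both maps keep `x^a t` or kill it by the same criterion, since `(1, a)` lies in
the monoid of `G` only when `a` is a generator on `G`. Compatibility of families thereby becomes an
equality of coefficients. -/
theorem transition_eq (hJ : IsMonomialIdeal J) (F G : CompactFace J) :
    transition J F G = (toFaceRing hJ G).comp (faceRingInclusion F.1) := by
  classical
  apply faceRing_algHom_ext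
  intro a
  refine Subtype.ext <| biCoeff_ext fun u => ?_
  rw [AlgHom.comp_apply, biCoeff_toFaceRing, transition_faceGen]
  have hval : biCoeff (faceRingInclusion F.1 (faceGen J F.1 a)).1 u =
      if (1, a.1) = u then (1 : K) else 0 := biCoeff_biMonomial (1, a.1) u 1
  rw [hval]
  split_ifs with h1 h2 h3 h2 h3
  · subst h3
    exact (biCoeff_biMonomial (1, a.1) _ (1 : K)).trans (if_pos rfl)
  · exact (biCoeff_biMonomial (1, a.1) u (1 : K)).trans (if_neg h3)
  · refine (biCoeff_biMonomial (1, a.1) u (1 : K)).trans (if_neg ?_)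
    rintro rfl
    exact h2 (AddSubmonoid.subset_closure ⟨a.1, ⟨a.2.1, h1⟩, rfl⟩)
  · subst h3
    exact absurd (genMonoid_fst_one h2 rfl).2 h1
  · exact biCoeff_zero u
  · exact biCoeff_zero u

open Classical in
theorem biCoeff_transition (hJ : IsMonomialIdeal J) (F G : CompactFace J) (f : faceRing J F.1)
    (u : ℕ × (Fin n →₀ ℕ)) : biCoeff (transition J F G f).1 u =
      if u ∈ genMonoid J G.1 then biCoeff f.1 u else 0 := by
  rw [transition_eq hJ, AlgHom.comp_apply, biCoeff_toFaceRing]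
  rfl

/-- The homomorphism from the Rees ring to the inverse limit of the rings `K[F]`. -/
def toInverseLimit (hJ : IsMonomialIdeal J) (𝓢 : Set (CompactFace J)) :
    reesAlgebra J →ₐ[K] inverseLimit J 𝓢 :=
  (AlgHom.pi fun F : 𝓢 => toFaceRing hJ F.1).codRestrict _
    fun f F G hGF => by
      classical
      refine Subtype.ext <| biCoeff_ext fun u => ?_
      change biCoeff (transition J F.1 G.1 (toFaceRing hJ F.1 f)).1 u =
        biCoeff (toFaceRing hJ G.1 f).1 u
      rw [biCoeff_transition hJ, biCoeff_toFaceRing, biCoeff_toFaceRing]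
      split_ifs with h1 h2
      · rfl
      · exact absurd (genMonoid_mono (faceGens_mono hGF) h1) h2
      · rfl

theorem toInverseLimit_apply (hJ : IsMonomialIdeal J) (𝓢 : Set (CompactFace J))
    (f : reesAlgebra J) (F : 𝓢) : (toInverseLimit hJ 𝓢 f).1 F = toFaceRing hJ F.1 f := rfl

end Truncation

/-! ### The kernel is the radical of `𝔪 R(J)`. -/

section Kernel

variable {J : Ideal (MvPolynomial (Fin n) K)}

/-- A variable has `t`-degree zero, where `K[F]` contains only constants. -/
theorem map_irrelevantIdeal_le_ker (hJ : IsMonomialIdeal J) (F : CompactFace J) :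
    (irrelevantIdeal K n).map (algebraMap (MvPolynomial (Fin n) K) (reesAlgebra J)) ≤
      RingHom.ker (toFaceRing hJ F) := by
  classical
  rw [Ideal.map_le_iff_le_comap, irrelevantIdeal, Ideal.span_le]
  rintro _ ⟨i, rfl⟩
  change toFaceRing hJ F (algebraMap _ _ (MvPolynomial.X i)) = 0
  refine Subtype.ext <| biCoeff_ext fun u => ?_
  rw [biCoeff_toFaceRing]
  have hval : biCoeff (algebraMap (MvPolynomial (Fin n) K) (reesAlgebra J)
      (MvPolynomial.X i)).1 u = if (0, Finsupp.single i 1) = u then (1 : K) else 0 :=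
    biCoeff_biMonomial (0, Finsupp.single i 1) u 1
  rw [hval]
  refine Eq.trans ?_ (biCoeff_zero u).symm
  split_ifs with h1 h2
  · subst h2
    simpa using congrArg (fun v => v.2 i) (genMonoid_fst_zero h1 rfl)
  · rfl
  · rfl

theorem biMonomial_mem_radical {u : ℕ × (Fin n →₀ ℕ)} (hu : u ∈ reesMonoid J) (hu0 : u ≠ 0)
    (h : ∀ w : Fin n → ℝ, (∀ i, 0 < w i) → u ∉ genMonoid J (weightFace J w)) (c : K) :
    (⟨biMonomial u c, biMonomial_mem_reesAlgebra hu c⟩ : reesAlgebra J) ∈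
      ((irrelevantIdeal K n).map
        (algebraMap (MvPolynomial (Fin n) K) (reesAlgebra J))).radical := by
  obtain ⟨N, i, v, hv, hN⟩ := exists_nsmul_eq_add_single hu hu0 h
  refine ⟨N, ?_⟩
  have : (⟨biMonomial u c, biMonomial_mem_reesAlgebra hu c⟩ : reesAlgebra J) ^ N =
      algebraMap (MvPolynomial (Fin n) K) (reesAlgebra J) (MvPolynomial.X i) *
        ⟨biMonomial v (c ^ N), biMonomial_mem_reesAlgebra hv _⟩ := by
    refine Subtype.ext ?_
    change biMonomial u c ^ N = biMonomial (0, Finsupp.single i 1) 1 * biMonomial v (c ^ N)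
    rw [biMonomial_pow, biMonomial_mul, hN, one_mul]
  rw [this]
  exact Ideal.mul_mem_right _ _ (Ideal.mem_map_of_mem _ (Ideal.subset_span ⟨i, rfl⟩))

theorem minGens_nonempty_of_mem {u : ℕ × (Fin n →₀ ℕ)} {F : Set (Fin n → ℝ)}
    (hu : u ∈ genMonoid J F) (h : u ≠ 0) : (minGens J).Nonempty :=
  (faceGens_nonempty_of_mem hu h).mono fun _ h => h.1

theorem mem_of_biMonomial_mem (I : Ideal (reesAlgebra J)) (f : reesAlgebra J)
    (hf : ∀ u, biCoeff f.1 u ≠ 0 →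
      ∃ h, (⟨biMonomial u (biCoeff f.1 u), h⟩ : reesAlgebra J) ∈ I) : f ∈ I := by
  have key : ∃ h : f.1 ∈ reesAlgebra J, (⟨f.1, h⟩ : reesAlgebra J) ∈ I := by
    rw [eq_sum_biMonomial f.1]
    refine Finset.sum_induction _ (fun g => ∃ h : g ∈ reesAlgebra J,
      (⟨g, h⟩ : reesAlgebra J) ∈ I) ?_ ⟨zero_mem _, I.zero_mem⟩
      fun u hu => hf u (by simpa using hu)
    rintro g g' ⟨h, hg⟩ ⟨h', hg'⟩
    have heq : (⟨g + g', add_mem h h'⟩ : reesAlgebra J) = ⟨g, h⟩ + ⟨g', h'⟩ := Subtype.ext rfl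
    refine ⟨add_mem h h', ?_⟩
    rw [heq]
    exact I.add_mem hg hg'
  exact key.2

/-- An element of the kernel has no monomial in any `K[F]`, so each of its monomials is in the
radical by `biMonomial_mem_radical`. Conversely, nilpotents vanish in each `K[F]`. Nonemptiness of
`𝓢` rules out a constant term. -/
theorem ker_toInverseLimit (hJ : IsMonomialIdeal J) {𝓢 : Set (CompactFace J)}
    (h𝓢 : 𝓢.Nonempty) (hmem : ∀ F : CompactFace J, F.1.Nonempty → F ∈ 𝓢) :
    RingHom.ker (toInverseLimit hJ 𝓢) = ((irrelevantIdeal K n).map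
        (algebraMap (MvPolynomial (Fin n) K) (reesAlgebra J))).radical := by
  classical
  refine le_antisymm (fun f hf => ?_) ?_
  · have hzero : ∀ F ∈ 𝓢, ∀ u ∈ genMonoid J F.1, biCoeff f.1 u = 0 := fun F hF u hu => by
      have h1 : toFaceRing hJ F f = 0 := congrFun (congrArg Subtype.val hf) ⟨F, hF⟩
      have h2 := biCoeff_toFaceRing hJ F f u
      rw [if_pos hu, h1] at h2
      exact h2.symm.trans (biCoeff_zero u)
    refine mem_of_biMonomial_mem _ f fun u hu => ?_
    have huS := mem_reesMonoid_of_biCoeff_ne_zero hJ f.2 u hu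
    refine ⟨_, biMonomial_mem_radical huS ?_ (fun w hw hgen => ?_) _⟩
    · rintro rfl
      obtain ⟨F, hF⟩ := h𝓢
      exact hu (hzero F hF 0 (zero_mem _))
    · have hu0 : u ≠ 0 := by
        rintro rfl
        obtain ⟨F, hF⟩ := h𝓢
        exact hu (hzero F hF 0 (zero_mem _))
      have hne := minGens_nonempty_of_mem hgen hu0
      obtain ⟨a, ha⟩ := faceGens_nonempty_of_mem hgen hu0
      exact hu (hzero ⟨weightFace J w, isExposed_weightFace J w, isCompact_weightFace hne hw⟩
        (hmem _ ⟨_, ha.2⟩) u hgen)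
  · rintro f ⟨N, hN⟩
    refine Subtype.ext <| funext fun F => ?_
    have := map_irrelevantIdeal_le_ker hJ F.1 hN
    rw [RingHom.mem_ker, map_pow] at this
    exact eq_zero_of_pow_eq_zero this

end Kernel

/-! ### Gluing compatible families. -/

section Surjective

variable {J : Ideal (MvPolynomial (Fin n) K)} {𝓢 : Set (CompactFace J)}

theorem biCoeff_eq_of_subset (hJ : IsMonomialIdeal J) (m : inverseLimit J 𝓢) {F G : 𝓢}
    (h : G.1.1 ⊆ F.1.1) {u : ℕ × (Fin n →₀ ℕ)} (hu : u ∈ genMonoid J G.1.1) :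
    biCoeff (m.1 F).1 u = biCoeff (m.1 G).1 u := by
  classical
  rw [← m.2 F G h, biCoeff_transition hJ, if_pos hu]

theorem biCoeff_eq_of_inter_mem (hJ : IsMonomialIdeal J) (m : inverseLimit J 𝓢) (F G : 𝓢)
    {E : CompactFace J} (hE : E ∈ 𝓢) (hEFG : E.1 = F.1.1 ∩ G.1.1) {u : ℕ × (Fin n →₀ ℕ)}
    (hF : u ∈ genMonoid J F.1.1) (hG : u ∈ genMonoid J G.1.1) :
    biCoeff (m.1 F).1 u = biCoeff (m.1 G).1 u := by
  have hu := genMonoid_inter F.1 G.1 hF hG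
  rw [← hEFG] at hu
  have h1 : E.1 ⊆ F.1.1 := hEFG ▸ Set.inter_subset_left
  have h2 : E.1 ⊆ G.1.1 := hEFG ▸ Set.inter_subset_right
  exact (biCoeff_eq_of_subset hJ m (G := ⟨E, hE⟩) h1 hu).trans
    (biCoeff_eq_of_subset hJ m (G := ⟨E, hE⟩) h2 hu).symm

/-- The intersection of two compact faces. -/
def interFace (F G : CompactFace J) : CompactFace J :=
  ⟨F.1 ∩ G.1, F.2.1.inter G.2.1, F.2.2.inter G.2.2⟩

/-- A nonzero shared bidegree forces a generator in `F ∩ G`, so the intersection is a nonempty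
compact face at which the two components can be compared. Bidegree zero gives no such generator and
is left to `hconst`. -/
theorem biCoeff_eq_of_mem (hJ : IsMonomialIdeal J)
    (hmem : ∀ F : CompactFace J, F.1.Nonempty → F ∈ 𝓢) (m : inverseLimit J 𝓢)
    (hconst : ∀ F G, biCoeff (m.1 F).1 0 = biCoeff (m.1 G).1 0) (F G : 𝓢)
    {u : ℕ × (Fin n →₀ ℕ)} (hF : u ∈ genMonoid J F.1.1) (hG : u ∈ genMonoid J G.1.1) :
    biCoeff (m.1 F).1 u = biCoeff (m.1 G).1 u := by
  by_cases hu : u = 0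
  · rw [hu]
    exact hconst F G
  · obtain ⟨a, ha⟩ := faceGens_nonempty_of_mem (genMonoid_inter F.1 G.1 hF hG) hu
    exact biCoeff_eq_of_inter_mem hJ m F G (hmem (interFace F.1 G.1) ⟨_, ha.2⟩) rfl hF hG

theorem toInverseLimit_surjective (hJ : IsMonomialIdeal J)
    (hmem : ∀ F : CompactFace J, F.1.Nonempty → F ∈ 𝓢)
    (hconst : ∀ (m : inverseLimit J 𝓢) F G, biCoeff (m.1 F).1 0 = biCoeff (m.1 G).1 0) :
    Function.Surjective (toInverseLimit hJ 𝓢) := by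
  classical
  intro m
  have hglue : ∀ u, ∃ c : K, (∀ F : 𝓢, u ∈ genMonoid J F.1.1 → biCoeff (m.1 F).1 u = c) ∧
      (c ≠ 0 → ∃ F : 𝓢, u ∈ genMonoid J F.1.1) := fun u => by
    by_cases h : ∃ F : 𝓢, u ∈ genMonoid J F.1.1
    · obtain ⟨G, hG⟩ := h
      exact ⟨biCoeff (m.1 G).1 u, fun F hF =>
        biCoeff_eq_of_mem hJ hmem m (hconst m) F G hF hG, fun _ => ⟨G, hG⟩⟩
    · exact ⟨0, fun F hF => absurd ⟨F, hF⟩ h, fun h => absurd rfl h⟩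
  choose c hc hc' using hglue
  let gens : 𝓢 → Set (Fin n →₀ ℕ) := fun F => faceGens J F.1.1
  -- The monoid of a face depends only on its generators, and there are finitely many sets of
  -- generators. One representative face for each detects all nonzero glued coefficients, so the
  -- glued element is a polynomial.
  have hgens : (Set.range gens).Finite :=
    (finite_minGens J).powerset.subset (by rintro _ ⟨F, rfl⟩ a ha; exact ha.1)
  have hfin : {u | c u ≠ 0}.Finite := by
    have := hgens.to_subtype
    refine (Set.finite_iUnion fun s : Set.range gens =>
      finite_biCoeff_ne_zero (m.1 s.2.choose).1).subset fun u hu => ?_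
    obtain ⟨F, hF⟩ := hc' u hu
    refine Set.mem_iUnion.2 ⟨⟨gens F, F, rfl⟩, ?_⟩
    have hs : gens _ = gens F := (⟨F, rfl⟩ : ∃ G, gens G = gens F).choose_spec
    have hG := genMonoid_mono (J := J) hs.ge hF
    exact ((hc u _ hG).trans_ne hu :)
  obtain ⟨f, hf⟩ := exists_biCoeff_eq c hfin
  have hfR : f ∈ reesAlgebra J := mem_reesAlgebra_of_biCoeff fun u hu => by
    rw [hf] at hu
    obtain ⟨F, hF⟩ := hc' u hu
    exact genMonoid_le_reesMonoid _ hF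
  refine ⟨⟨f, hfR⟩, Subtype.ext <| funext fun F => Subtype.ext <| biCoeff_ext fun u => ?_⟩
  rw [toInverseLimit_apply, biCoeff_toFaceRing, hf]
  split_ifs with hu
  · exact (hc u F hu).symm
  · exact (biCoeff_eq_zero_of_mem_faceRing (m.1 F).2 hu).symm

/-- The reduced fiber ring as a quotient of the Rees ring. -/
def toReducedFiberRing (J : Ideal (MvPolynomial (Fin n) K)) :
    reesAlgebra J →ₐ[K] ReducedFiberRing J :=
  AlgHom.comp (B := FiberRing J) (Ideal.Quotient.mkₐ K (nilradical (FiberRing J)))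
    (Ideal.Quotient.mkₐ K ((irrelevantIdeal K n).map
      (algebraMap (MvPolynomial (Fin n) K) (reesAlgebra J))))

theorem toReducedFiberRing_surjective (J : Ideal (MvPolynomial (Fin n) K)) :
    Function.Surjective (toReducedFiberRing J) :=
  (Ideal.Quotient.mk_surjective (I := nilradical (FiberRing J))).comp
    (Ideal.Quotient.mk_surjective (I := (irrelevantIdeal K n).map
      (algebraMap (MvPolynomial (Fin n) K) (reesAlgebra J))))

theorem ker_toReducedFiberRing (J : Ideal (MvPolynomial (Fin n) K)) :
    RingHom.ker (toReducedFiberRing J) = ((irrelevantIdeal K n).map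
      (algebraMap (MvPolynomial (Fin n) K) (reesAlgebra J))).radical := by
  ext f
  set I := (irrelevantIdeal K n).map (algebraMap (MvPolynomial (Fin n) K) (reesAlgebra J))
  have h1 : f ∈ RingHom.ker (toReducedFiberRing J) ↔
      IsNilpotent (Ideal.Quotient.mk I f) :=
    Ideal.Quotient.eq_zero_iff_mem (I := nilradical (FiberRing J))
  rw [h1]
  refine exists_congr fun N => ?_
  rw [← map_pow, Ideal.Quotient.eq_zero_iff_mem]

theorem nonempty_algEquiv_inverseLimit (hJ : IsMonomialIdeal J)
    (h𝓢 : 𝓢.Nonempty) (hmem : ∀ F : CompactFace J, F.1.Nonempty → F ∈ 𝓢)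
    (hconst : ∀ (m : inverseLimit J 𝓢) F G, biCoeff (m.1 F).1 0 = biCoeff (m.1 G).1 0) :
    Nonempty (ReducedFiberRing J ≃ₐ[K] inverseLimit J 𝓢) :=
  ⟨(Ideal.quotientKerAlgEquivOfSurjective (toReducedFiberRing_surjective J)).symm.trans <|
    (Ideal.quotientEquivAlgOfEq K ((ker_toReducedFiberRing J).trans
      (ker_toInverseLimit hJ h𝓢 hmem).symm)).trans <|
    Ideal.quotientKerAlgEquivOfSurjective (toInverseLimit_surjective hJ hmem hconst)⟩

end Surjective

/-! ### Constant terms without the empty face. -/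

section Connectedness

open Topology

variable {J : Ideal (MvPolynomial (Fin n) K)}

theorem minGens_nonempty (hJ : IsMonomialIdeal J) (h : J ≠ ⊥) : (minGens J).Nonempty := by
  obtain ⟨f, hf, hf0⟩ := Submodule.exists_mem_ne_zero_of_ne_bot h
  obtain ⟨b, hb⟩ := MvPolynomial.ne_zero_iff.1 hf0
  obtain ⟨a, -, ha⟩ := exists_minGens_le (mem_exponents_of_coeff_ne_zero hJ hf hb)
  exact ⟨a, ha⟩

theorem weightFace_nonempty (hne : (minGens J).Nonempty) {w : Fin n → ℝ} (hw : ∀ i, 0 < w i) :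
    (weightFace J w).Nonempty := by
  obtain ⟨a, ha, hmin⟩ := exists_minimizer hne w
  exact ⟨_, (toReal_mem_weightFace hw ha hmin ha).2 rfl⟩

theorem continuous_dot (x : Fin n → ℝ) : Continuous fun w => dot w x := by
  simp only [dot_apply]
  fun_prop

/-- The finitely many strict inequalities between weights of generators persist near `w`, so
generators minimal for `w'` are already minimal for `w`; the faces are the convex hulls of such
generators. -/
theorem eventually_weightFace_subset (hne : (minGens J).Nonempty) {w : Fin n → ℝ}
    (hw : ∀ i, 0 < w i) :
    ∀ᶠ w' in 𝓝 w, (∀ i, 0 < w' i) → weightFace J w' ⊆ weightFace J w := by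
  obtain ⟨a, ha, hmin⟩ := exists_minimizer hne w
  have h : ∀ᶠ w' in 𝓝 w, ∀ b ∈ minGens J, dot w (toReal a) < dot w (toReal b) →
      dot w' (toReal a) < dot w' (toReal b) := by
    refine (Filter.eventually_all_finite (finite_minGens J)).2 fun b _ => ?_
    by_cases hb : dot w (toReal a) < dot w (toReal b)
    · filter_upwards [(continuous_dot (toReal a)).continuousAt.eventually_lt
        (continuous_dot (toReal b)).continuousAt hb] with w' hw' _ using hw'
    · exact Filter.Eventually.of_forall fun _ h => absurd h hb
  filter_upwards [h] with w' h hw'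
  obtain ⟨a', ha', hmin'⟩ := exists_minimizer hne w'
  rw [weightFace_eq_convexHull hw' ha' hmin']
  refine convexHull_min ?_ ((isExposed_weightFace J w).convex (convex_convexHull ℝ _))
  rintro _ ⟨b, ⟨hb, hba'⟩, rfl⟩
  rw [toReal_mem_weightFace hw ha hmin hb]
  by_contra hlt
  have := h b hb ((hmin b hb).lt_of_ne' hlt)
  exact absurd (hmin' a ha) (by linarith)

/-- Constant terms agree along the family of nonempty compact faces: the face cut out by a
positive weight `w` depends upper semicontinuously on `w`, and the positive weights form a
connected set. -/
theorem biCoeff_zero_eq (hJ : IsMonomialIdeal J) (hne : (minGens J).Nonempty)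
    (m : inverseLimit J {F | F.1.Nonempty}) (F G : {F : CompactFace J | F.1.Nonempty}) :
    biCoeff (m.1 F).1 0 = biCoeff (m.1 G).1 0 := by
  let O : Set (Fin n → ℝ) := {w | ∀ i, 0 < w i}
  have hO : Convex ℝ O := by
    have : O = Set.univ.pi fun _ => Set.Ioi 0 := by ext; simp [O]
    rw [this]
    exact convex_pi fun _ _ => convex_Ioi 0
  have : PreconnectedSpace O := Subtype.preconnectedSpace hO.isPreconnected
  let face : O → {F : CompactFace J | F.1.Nonempty} := fun w =>
    ⟨⟨weightFace J w.1, isExposed_weightFace J w.1, isCompact_weightFace hne w.2⟩,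
      weightFace_nonempty hne w.2⟩
  -- For `w'` near `w` the face of `w'` is contained in that of `w`, and the transition map between
  -- them preserves constant terms.
  have hloc : IsLocallyConstant fun w : O => biCoeff (m.1 (face w)).1 0 := by
    rw [IsLocallyConstant.iff_eventually_eq]
    intro w
    have h := continuous_subtype_val.continuousAt.eventually
      (eventually_weightFace_subset hne w.2)
    filter_upwards [h] with w' h
    exact (biCoeff_eq_of_subset hJ m (F := face w) (G := face w') (h w'.2) (zero_mem _)).symm
  have hface : ∀ F, ∃ w, face w = F := fun F => by
    obtain ⟨w, hw, hF⟩ := exists_weightFace_eq F.1 F.2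
    exact ⟨⟨w, hw⟩, Subtype.ext (Subtype.ext hF.symm)⟩
  obtain ⟨w, rfl⟩ := hface F
  obtain ⟨w', rfl⟩ := hface G
  exact hloc.apply_eq_of_preconnectedSpace w w'

end Connectedness

end NewtonFiber

end

/-! ### The two index sets of faces. -/

theorem theorem4p8 {K : Type*} [Field K] {n : ℕ} (J : Ideal (MvPolynomial (Fin n) K))
    (hJ : NewtonFiber.IsExtremalIdeal J) :
    Nonempty (NewtonFiber.ReducedFiberRing J ≃ₐ[K] NewtonFiber.inverseLimit J Set.univ) ∧
    (J ≠ ⊥ → Nonempty (NewtonFiber.ReducedFiberRing J ≃ₐ[K]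
      NewtonFiber.inverseLimit J {F | F.1.Nonempty})) := by
  have hempty : IsExposed ℝ (NewtonFiber.newton J) ∅ ∧ IsCompact (∅ : Set (Fin n → ℝ)) :=
    ⟨isExposed_empty, isCompact_empty⟩
  refine ⟨NewtonFiber.nonempty_algEquiv_inverseLimit hJ.1 ⟨⟨∅, hempty⟩, trivial⟩
    (fun _ _ => trivial) fun m F G => ?_, fun hbot => ?_⟩
  -- The empty face lies in every face, so all constant terms agree with its component.
  · exact (NewtonFiber.biCoeff_eq_of_subset hJ.1 m (G := ⟨⟨∅, hempty⟩, trivial⟩)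
      (Set.empty_subset _) (zero_mem _)).trans (NewtonFiber.biCoeff_eq_of_subset hJ.1 m
      (Set.empty_subset _) (zero_mem _)).symm
  · have hne := NewtonFiber.minGens_nonempty hJ.1 hbot
    -- The all-ones weight supplies a nonempty compact face.
    have hw : ∀ i : Fin n, (0 : ℝ) < (fun _ => 1 : Fin n → ℝ) i := fun _ => one_pos
    exact NewtonFiber.nonempty_algEquiv_inverseLimit hJ.1
      ⟨⟨NewtonFiber.weightFace J _, NewtonFiber.isExposed_weightFace J _,
        NewtonFiber.isCompact_weightFace hne hw⟩, NewtonFiber.weightFace_nonempty hne hw⟩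
      (fun _ h => h) (NewtonFiber.biCoeff_zero_eq hJ.1 hne)
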